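/- Let $\mathrm{LA}_2$ be the theory in the language $\langle 0,1,+,\le,a,b\rangle$ ($a,b$ unary function symbols) with the axioms $0\ne z+1$; $x+1=y+1\to x=y$; $x+0=x$; $x+(y+1)=(x+y)+1$; $x\le y\leftrightarrow\exists z\,(x+z=y)$; $c(x+1)=cx+c1$ for $c\in\{a,b\}$; $a(bx)=b(ax)$; and the induction scheme for all formulas of this language. For a model $\mathcal M\models\mathrm{LA}_2$, let $\mathcal A=\langle A,0,+,-,\le,r\rangle_{r\in R}$ be the corresponding discretely ordered module: $A$ is the ordered abelian group of formal differences of elements of $M$ (so $M=A_{\ge 0}$), with $a,b$ extended additively, and $R=\mathbb Z[a,b]/\mathrm{Ann}(A)$ is the ring generated by the two scalars, ordered by $[p]\le[q]\iff p1\le q1$. A structure is NIP if there is no formula $\varphi(\bar x,\bar y)$ such that for every $n\in\omega$ there are tuples $\bar a_i$ ($i<n$) and $\bar b_J$ ($J\subseteq n$) with $\varphi(\bar a_i,\bar b_J)\Leftrightarrow i\in J$. **Proposition 4.1.** (i) Let $\mathcal M\models \mathrm{LA}_2$, let $L\in M$ be non-standard (different from every numeral $0,1,1+1,\dots$), and let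 $\cdot$ be an operation with $x\cdot 0=0$ and $x\cdot(y+1)=x\cdot y+x$ on $[0,L]^2$ whose graph on $[0,L]^2$ is definable in $\mathcal M$ with parameters from a set $P\subseteq M$ (possibly $P=\emptyset$). Then the relation on $A$ $$\varphi(x,y):\quad 0\le x\le L\ \text{ and there is } z \text{ with } 0\le z\le y,\ z\le L,\ z\cdot x=y$$ is definable in $\mathcal A$ with parameters from $P$; for $i,j\in\mathbb N$, $\varphi(i1,j1)$ holds if and only if $i$ divides $j$; $\varphi$ has the independence property, i.e. for every $n$ there are $a_i\in A$ ($i<n$) and $b_J\in A$ ($J\subseteq n$) with $\varphi(a_i,b_J)\Leftrightarrow i\in J$; and $\mathcal A$ is not NIP. (ii) There are $\mathcal M\models\mathrm{LA}_2$, a non-standard $L\in M$ and such an operation $\cdot$ whose graph on $[0,L]^2$ is definable in $\mathcal M$ without parameters. (iii) Consequently there is a discretely ordered module over a discretely ordered commutative ring that is not NIP; in particular not all ordered modules are NIP, which answers Question 5.9.1 of Chernikov and Hils negatively. -/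

import Mathlib

namespace LinearArithmetic

open FirstOrder FirstOrder.Language

universe u v

/-! ### The language of linear arithmetic and its structures -/

/-- Function symbols `0, 1, +` and one unary symbol for every `α ∈ κ`. -/
inductive LinFunc (κ : Type v) : ℕ → Type v
  | zero : LinFunc κ 0
  | one : LinFunc κ 0
  | add : LinFunc κ 2
  | scalar (α : κ) : LinFunc κ 1

/-- The only relation symbol is the binary symbol `≤`. -/
inductive OrdRel : ℕ → Type
  | le : OrdRel 2

/-- The language `⟨0, 1, +, ≤, a_α⟩_{α ∈ κ}`. -/
def linLang (κ : Type v) : FirstOrder.Language.{v, 0} := ⟨LinFunc κ, OrdRel⟩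

/-- The data of a structure `⟨M, 0, 1, +, ≤, a_α⟩_{α ∈ κ}`, without any axioms. -/
class LinStruct (κ : outParam (Type v)) (M : Type u) extends Zero M, One M, Add M, LE M where
  scalar : κ → M → M

open LinStruct

/-- The first-order structure given by the data. -/
instance linStructure {κ : Type v} {M : Type u} [LinStruct κ M] : (linLang κ).Structure M where
  funMap {_} f := match f with
    | .zero => fun _ => 0
    | .one => fun _ => 1
    | .add => fun x => x 0 + x 1
    | .scalar α => fun x => scalar α (x 0)
  RelMap {_} r := match r with
    | .le => fun x => x 0 ≤ x 1

/-- `M` is a model of `κ`-linear arithmetic; the last field is the scheme of induction for all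
formulas of the language, with parameters `y`. -/
class IsLAModel {κ : Type v} (M : Type u) [LinStruct κ M] : Prop where
  zero_ne_succ : ∀ z : M, 0 ≠ z + 1
  succ_inj : ∀ x y : M, x + 1 = y + 1 → x = y
  add_zero' : ∀ x : M, x + 0 = x
  add_succ : ∀ x y : M, x + (y + 1) = (x + y) + 1
  le_iff : ∀ x y : M, x ≤ y ↔ ∃ z, x + z = y
  scalar_succ : ∀ (α : κ) (x : M), scalar α (x + 1) = scalar α x + scalar α (1 : M)
  scalar_comm : ∀ (α β : κ) (x : M), scalar α (scalar β x) = scalar β (scalar α x)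
  induction : ∀ (n : ℕ) (φ : (linLang κ).Formula (Fin n ⊕ Fin 1)) (y : Fin n → M),
    φ.Realize (Sum.elim y fun _ => (0 : M)) →
    (∀ x : M, φ.Realize (Sum.elim y fun _ => x) → φ.Realize (Sum.elim y fun _ => x + 1)) →
    ∀ x : M, φ.Realize (Sum.elim y fun _ => x)

/-! ### Elementary consequences of the axioms -/

section Basic

variable {κ : Type v} {M : Type u} [LinStruct κ M]

/-- The sum of two terms. -/
def tAdd {α : Type*} (s t : (linLang κ).Term α) : (linLang κ).Term α :=
  Functions.apply₂ (L := linLang κ) LinFunc.add s t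

/-- The term `0`. -/
def tZero {α : Type*} : (linLang κ).Term α :=
  Constants.term (L := linLang κ) LinFunc.zero

/-- The term `1`. -/
def tOne {α : Type*} : (linLang κ).Term α :=
  Constants.term (L := linLang κ) LinFunc.one

/-- The term `a_c t`. -/
def tScalar {α : Type*} (c : κ) (t : (linLang κ).Term α) : (linLang κ).Term α :=
  Functions.apply₁ (L := linLang κ) (LinFunc.scalar c) t

/-- The atomic formula `s ≤ t`. -/
def fLe {α : Type*} (s t : (linLang κ).Term α) : (linLang κ).Formula α :=
  Relations.formula₂ (L := linLang κ) OrdRel.le s t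

@[simp] theorem realize_tAdd {α : Type*} (v : α → M) (s t : (linLang κ).Term α) :
    (tAdd s t).realize v = s.realize v + t.realize v :=
  Term.realize_functions_apply₂ (L := linLang κ) (M := M)

@[simp] theorem realize_tZero {α : Type*} (v : α → M) :
    (tZero : (linLang κ).Term α).realize v = 0 := rfl

@[simp] theorem realize_tOne {α : Type*} (v : α → M) :
    (tOne : (linLang κ).Term α).realize v = 1 := rfl

@[simp] theorem realize_tScalar {α : Type*} (v : α → M) (c : κ) (t : (linLang κ).Term α) :
    (tScalar c t).realize v = scalar c (t.realize v) :=
  Term.realize_functions_apply₁ (L := linLang κ) (M := M)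

@[simp] theorem realize_fLe {α : Type*} (v : α → M) (s t : (linLang κ).Term α) :
    (fLe s t).Realize v ↔ s.realize v ≤ t.realize v :=
  Formula.realize_rel₂ (L := linLang κ) (M := M)

variable [IsLAModel M]

open IsLAModel

theorem ind (n : ℕ) (φ : (linLang κ).Formula (Fin n ⊕ Fin 1)) (y : Fin n → M) (p : M → Prop)
    (hp : ∀ x, φ.Realize (Sum.elim y fun _ => x) ↔ p x) (h0 : p 0)
    (hs : ∀ x, p x → p (x + 1)) (x : M) : p x := by
  simp only [← hp] at *
  exact IsLAModel.induction n φ y h0 hs x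

theorem zero_add' (x : M) : 0 + x = x := by
  refine ind 0 (Term.equal (tAdd tZero (.var (.inr 0))) (.var (.inr 0))) ![]
    (fun x => (Zero.zero : M) + x = x) (fun x => by simp; rfl) (add_zero' 0) (fun x hx => ?_) x
  rw [add_succ, hx]

theorem succ_add' (x y : M) : x + 1 + y = x + y + 1 := by
  refine ind 1 (Term.equal (tAdd (tAdd (.var (.inl 0)) tOne) (.var (.inr 0)))
    (tAdd (tAdd (.var (.inl 0)) (.var (.inr 0))) tOne)) ![x] (fun y => x + 1 + y = x + y + 1)
    (fun y => by simp) ?_ (fun y hy => ?_) y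
  · rw [add_zero', add_zero']
  · rw [add_succ, hy, add_succ]

theorem add_comm' (x y : M) : x + y = y + x := by
  refine ind 1 (Term.equal (tAdd (.var (.inl 0)) (.var (.inr 0)))
    (tAdd (.var (.inr 0)) (.var (.inl 0)))) ![x] (fun y => x + y = y + x)
    (fun y => by simp) ?_ (fun y hy => ?_) y
  · rw [add_zero', zero_add']
  · rw [add_succ, hy, succ_add']

theorem add_assoc' (x y z : M) : x + y + z = x + (y + z) := by
  refine ind 2 (Term.equal (tAdd (tAdd (.var (.inl 0)) (.var (.inl 1))) (.var (.inr 0)))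
    (tAdd (.var (.inl 0)) (tAdd (.var (.inl 1)) (.var (.inr 0))))) ![x, y]
    (fun z => x + y + z = x + (y + z)) (fun z => by simp) ?_ (fun z hz => ?_) z
  · rw [add_zero', add_zero']
  · rw [add_succ, hz, add_succ, add_succ]

/-- The additive monoid of a model. -/
abbrev addCommMonoid : AddCommMonoid M where
  add_assoc := add_assoc'
  zero_add := zero_add'
  add_zero := add_zero'
  add_comm := add_comm'
  nsmul := nsmulRec

theorem add_cancel' (x y z : M) (h : x + z = y + z) : x = y := by
  by_contra hxy
  refine ind 2 (∼(Term.equal (tAdd (.var (.inl 0)) (.var (.inr 0)))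
    (tAdd (.var (.inl 1)) (.var (.inr 0))))) ![x, y] (fun z => ¬ x + z = y + z)
    (fun z => by simp) ?_ (fun z hz => ?_) z h
  · rwa [add_zero', add_zero']
  · rw [add_succ, add_succ]
    exact fun h => hz (succ_inj _ _ h)

theorem zero_or_one_le (x : M) : x = 0 ∨ 1 ≤ x := by
  refine ind 0 (Term.equal (.var (.inr 0)) tZero ⊔ fLe tOne (.var (.inr 0))) ![]
    (fun x => x = (Zero.zero : M) ∨ 1 ≤ x) (fun x => by simp; rfl) (Or.inl rfl) (fun x _ => Or.inr ?_) x
  exact (le_iff _ _).2 ⟨x, add_comm' _ _⟩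

theorem exists_pred {x : M} (h : x ≠ 0) : ∃ y, x = y + 1 := by
  obtain h' | h' := zero_or_one_le x
  · exact absurd h' h
  · obtain ⟨z, hz⟩ := (le_iff _ _).1 h'
    exact ⟨z, by rw [← hz, add_comm']⟩

theorem add_eq_zero' {x y : M} (h : x + y = 0) : y = 0 := by
  by_contra hy
  obtain ⟨z, rfl⟩ := exists_pred hy
  exact zero_ne_succ _ (h.symm.trans (add_succ _ _))

theorem le_total' (x y : M) : x ≤ y ∨ y ≤ x := by
  refine ind 1 (fLe (.var (.inl 0)) (.var (.inr 0)) ⊔ fLe (.var (.inr 0)) (.var (.inl 0))) ![x]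
    (fun y => x ≤ y ∨ y ≤ x) (fun y => by simp) (Or.inr ((le_iff _ _).2 ⟨x, zero_add' x⟩))
    (fun y hy => ?_) y
  simp only [le_iff] at hy ⊢
  rcases hy with ⟨z, hz⟩ | ⟨z, hz⟩
  · exact Or.inl ⟨z + 1, by rw [add_succ, hz]⟩
  · by_cases h0 : z = 0
    · exact Or.inl ⟨1, by rw [← hz, h0, add_zero']⟩
    · obtain ⟨w, rfl⟩ := exists_pred h0
      exact Or.inr ⟨w, by rw [succ_add', ← hz, add_succ]⟩

open Classical in
/-- The order of a model is linear. -/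
noncomputable abbrev linearOrder : LinearOrder M where
  le_refl x := (le_iff _ _).2 ⟨0, add_zero' x⟩
  le_trans x y z h h' := by
    obtain ⟨a, rfl⟩ := (le_iff _ _).1 h
    obtain ⟨b, rfl⟩ := (le_iff _ _).1 h'
    exact (le_iff _ _).2 ⟨a + b, (add_assoc' _ _ _).symm⟩
  le_antisymm x y h h' := by
    obtain ⟨a, rfl⟩ := (le_iff _ _).1 h
    obtain ⟨b, hb⟩ := (le_iff _ _).1 h'
    rw [add_assoc'] at hb
    have : a + b = 0 := add_cancel' _ _ x (by rw [add_comm', hb, zero_add'])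
    rw [add_comm'] at this
    rw [add_eq_zero' this, add_zero']
  le_total := le_total'
  toDecidableLE := inferInstance

attribute [local instance] addCommMonoid linearOrder

theorem isOrderedCancelAddMonoid : IsOrderedCancelAddMonoid M where
  add_le_add_left x y h z := by
    obtain ⟨a, rfl⟩ := (le_iff _ _).1 h
    exact (le_iff _ _).2 ⟨a, add_right_comm _ _ _⟩
  le_of_add_le_add_left x y z h := by
    obtain ⟨a, ha⟩ := (le_iff _ _).1 h
    refine (le_iff _ _).2 ⟨a, add_cancel' _ _ x ?_⟩
    rw [add_comm', ← add_assoc', ha, add_comm']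

theorem zero_le' (x : M) : 0 ≤ x := (le_iff _ _).2 ⟨x, zero_add' x⟩

theorem scalar_zero (c : κ) : scalar c (0 : M) = 0 := by
  have h := scalar_succ c (0 : M)
  rw [zero_add'] at h
  exact add_cancel' _ _ (scalar c (1 : M)) (by rw [← h, zero_add'])

theorem scalar_add (c : κ) (x y : M) : scalar c (x + y) = scalar c x + scalar c y := by
  refine ind 1 (Term.equal (tScalar c (tAdd (.var (.inl 0)) (.var (.inr 0))))
    (tAdd (tScalar c (.var (.inl 0))) (tScalar c (.var (.inr 0))))) ![x]
    (fun y => scalar c (x + y) = scalar c x + scalar c y) (fun y => by simp) ?_ (fun y hy => ?_) y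
  · rw [add_zero', scalar_zero, add_zero']
  · rw [add_succ, scalar_succ, hy, scalar_succ, add_assoc']

/-- A scalar as an additive map of the model. -/
def scalarHom (c : κ) : M →+ M where
  toFun := scalar c
  map_zero' := scalar_zero c
  map_add' := scalar_add c

end Basic

/-! ### The ordered module of a model -/

section Extension

variable {κ : Type v} (M : Type u) [LinStruct κ M] [IsLAModel M]

attribute [local instance] addCommMonoid linearOrder isOrderedCancelAddMonoid

/-- The ordered abelian group of formal differences of elements of `M`: the model `M` with the
negative elements added. -/
def Ext : Type u := Algebra.GrothendieckAddGroup M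

namespace Ext

instance : AddCommGroup (Ext M) := inferInstanceAs (AddCommGroup (Algebra.GrothendieckAddGroup M))

noncomputable instance : LinearOrder (Ext M) :=
  inferInstanceAs (LinearOrder (AddLocalization (⊤ : AddSubmonoid M)))

instance : IsOrderedCancelAddMonoid (Ext M) :=
  inferInstanceAs (IsOrderedCancelAddMonoid (AddLocalization (⊤ : AddSubmonoid M)))

variable {M}

/-- The inclusion of `M` as the set of nonnegative elements. -/
def of : M →+ Ext M := Algebra.GrothendieckAddGroup.of (M := M)

theorem of_le_of {x y : M} : of x ≤ of y ↔ x ≤ y :=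
  (AddLocalization.mkOrderEmbedding (0 : (⊤ : AddSubmonoid M))).le_iff_le

theorem of_injective : Function.Injective (of (M := M)) :=
  fun _ _ h => le_antisymm (of_le_of.1 h.le) (of_le_of.1 h.ge)

theorem of_lt_of {x y : M} : of x < of y ↔ x < y := by
  rw [lt_iff_le_not_ge, of_le_of, of_le_of, lt_iff_le_not_ge]

theorem of_nonneg (x : M) : 0 ≤ of x := by
  rw [← map_zero of, of_le_of]
  exact zero_le' x

theorem exists_sub (z : Ext M) : ∃ x y : M, z = of x - of y := by
  induction z using AddLocalization.ind with
  | _ p =>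
    refine ⟨p.1, p.2, ?_⟩
    have h : ∀ x : M, of x = AddLocalization.mk x (0 : (⊤ : AddSubmonoid M)) := fun x =>
      (AddLocalization.mk_zero_eq_addMonoidOf_mk x).symm
    rw [h, h]
    refine Eq.trans ?_ (Algebra.GrothendieckAddGroup.mk_sub_mk _ _ _ _).symm
    refine AddLocalization.mk_eq_mk_iff.2 (AddLocalization.r_iff_exists.2 ⟨0, ?_⟩)
    simp

theorem exists_of_nonneg {z : Ext M} (h : 0 ≤ z) : ∃ x : M, z = of x := by
  obtain ⟨x, y, rfl⟩ := exists_sub z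
  obtain ⟨w, rfl⟩ := (IsLAModel.le_iff y x).1 (of_le_of.1 (sub_nonneg.1 h))
  exact ⟨w, by rw [map_add, add_sub_cancel_left]⟩

/-- The multiplication by a scalar, extended to the negative elements. -/
noncomputable def scalarEnd (c : κ) : AddMonoid.End (Ext M) :=
  (Algebra.GrothendieckAddGroup.lift (of.comp (scalarHom c)) : Algebra.GrothendieckAddGroup M →+ Ext M)

theorem scalarEnd_of (c : κ) (x : M) : scalarEnd c (of x) = of (scalar c x) :=
  DFunLike.congr_fun (Algebra.GrothendieckAddGroup.lift.symm_apply_apply (of.comp (scalarHom c))) x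

theorem scalarEnd_comm (c d : κ) :
    (scalarEnd c : AddMonoid.End (Ext M)) * scalarEnd d = scalarEnd d * scalarEnd c := by
  refine AddMonoidHom.ext fun z => ?_
  obtain ⟨x, y, rfl⟩ := exists_sub z
  change scalarEnd c (scalarEnd d _) = scalarEnd d (scalarEnd c _)
  simp only [map_sub, scalarEnd_of, IsLAModel.scalar_comm c d]

variable (M)

/-- The ring of endomorphisms generated by the scalars. -/
abbrev EndRing : Subring (AddMonoid.End (Ext M)) :=
  Subring.closure (Set.range scalarEnd)

/-- The ring generated by the scalars is commutative. -/
noncomputable abbrev endCommRing : CommRing (EndRing M) where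
  __ := (inferInstance : Ring (EndRing M))
  mul_comm := (Subring.isMulCommutative_closure
    (by rintro _ ⟨c, rfl⟩ _ ⟨d, rfl⟩; exact scalarEnd_comm c d)).is_comm.comm

/-- The action of the polynomials in the scalars, with integer coefficients, on the extended
model: the variable `X c` acts as the scalar `c`. -/
noncomputable def polyAction : MvPolynomial κ ℤ →+* AddMonoid.End (Ext M) :=
  letI := endCommRing M
  (EndRing M).subtype.comp
    (MvPolynomial.eval₂Hom (Int.castRingHom (EndRing M))
      fun c => ⟨scalarEnd c, Subring.subset_closure ⟨c, rfl⟩⟩)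

noncomputable instance : Module (MvPolynomial κ ℤ) (Ext M) :=
  Module.compHom (Ext M) (polyAction M)

variable {M}

theorem X_smul_of (c : κ) (x : M) :
    (MvPolynomial.X c : MvPolynomial κ ℤ) • of x = of (scalar c x) := by
  change polyAction M (MvPolynomial.X c) (of x) = _
  rw [← scalarEnd_of, polyAction]
  simp only [RingHom.comp_apply, MvPolynomial.coe_eval₂Hom, MvPolynomial.eval₂_X]
  rfl

theorem C_smul (n : ℤ) (z : Ext M) : (MvPolynomial.C n : MvPolynomial κ ℤ) • z = n • z := by
  rw [eq_intCast (MvPolynomial.C : ℤ →+* MvPolynomial κ ℤ) n, Int.cast_smul_eq_zsmul]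

theorem exists_terms (p : MvPolynomial κ ℤ) : ∃ s t : (linLang κ).Term (Fin 0 ⊕ Fin 1),
    ∀ x : M, p • of x = of (s.realize (Sum.elim ![] fun _ => x)) -
      of (t.realize (Sum.elim ![] fun _ => x)) := by
  induction p using MvPolynomial.induction_on with
  | C n =>
    simp only [C_smul]
    induction n using Int.induction_on with
    | zero => exact ⟨tZero, tZero, fun x => by rw [zero_smul, sub_self]⟩
    | succ n ih =>
      obtain ⟨s, t, h⟩ := ih
      refine ⟨tAdd s (.var (.inr 0)), t, fun x => ?_⟩
      rw [add_smul, h]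
      simp only [realize_tAdd, map_add, one_smul, Term.realize_var, Sum.elim_inr]
      abel
    | pred n ih =>
      obtain ⟨s, t, h⟩ := ih
      refine ⟨s, tAdd t (.var (.inr 0)), fun x => ?_⟩
      rw [sub_smul, h]
      simp only [realize_tAdd, map_add, one_smul, Term.realize_var, Sum.elim_inr]
      abel
  | add p q hp hq =>
    obtain ⟨s, t, h⟩ := hp
    obtain ⟨s', t', h'⟩ := hq
    refine ⟨tAdd s s', tAdd t t', fun x => ?_⟩
    rw [add_smul, h, h']
    simp only [realize_tAdd, map_add]
    abel
  | mul_X p c hp =>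
    obtain ⟨s, t, h⟩ := hp
    refine ⟨tScalar c s, tScalar c t, fun x => ?_⟩
    rw [mul_comm, mul_smul, h, smul_sub, X_smul_of, X_smul_of, realize_tScalar, realize_tScalar]

theorem one_le_of_pos {z : Ext M} (h : 0 < z) : of 1 ≤ z := by
  obtain ⟨x, rfl⟩ := exists_of_nonneg h.le
  obtain rfl | hx := zero_or_one_le x
  · exact absurd (map_zero of) h.ne'
  · exact of_le_of.2 hx

theorem zero_lt_of_one : (0 : Ext M) < of 1 := by
  refine lt_of_le_of_ne (of_nonneg _) fun h => ?_
  rw [← map_zero of] at h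
  have h' := of_injective h
  exact IsLAModel.zero_ne_succ (0 : M) (by rw [zero_add']; exact h')

theorem poly_smul_eq_zero {p : MvPolynomial κ ℤ} (h : p • of (1 : M) = 0) (z : Ext M) :
    p • z = 0 := by
  obtain ⟨s, t, hst⟩ := exists_terms (M := M) p
  have key : ∀ x : M, p • of x = 0 := by
    intro x
    refine ind 0 (Term.equal s t) ![] (fun x => p • of x = 0) (fun x => ?_) ?_ (fun x hx => ?_) x
    · rw [hst, sub_eq_zero, of_injective.eq_iff, Formula.realize_equal]
    · have h0 : of (0 : M) = 0 := map_zero of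
      exact (congrArg (p • ·) h0).trans (smul_zero p)
    · rw [map_add, smul_add, hx, h, add_zero]
  obtain ⟨x, y, rfl⟩ := exists_sub z
  rw [smul_sub, key, key, sub_zero]

theorem poly_smul_pos {p : MvPolynomial κ ℤ} (h : 0 < p • of (1 : M)) {z : Ext M} (hz : 0 < z) :
    0 < p • z := by
  obtain ⟨s, t, hst⟩ := exists_terms (M := M) p
  have key : ∀ x : M, of x ≤ p • of x := by
    intro x
    refine ind 0 (fLe (tAdd (.var (.inr 0)) t) s) ![] (fun x => of x ≤ p • of x)
      (fun x => ?_) ?_ (fun x hx => ?_) x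
    · rw [hst, le_sub_iff_add_le, ← map_add, of_le_of, realize_fLe, realize_tAdd]
      rfl
    · have h0 : of (0 : M) = 0 := map_zero of
      exact le_of_eq (h0.trans ((congrArg (p • ·) h0).trans (smul_zero p)).symm)
    · rw [map_add, smul_add]
      exact add_le_add hx (one_le_of_pos h)
  obtain ⟨x, rfl⟩ := exists_of_nonneg hz.le
  exact lt_of_lt_of_le hz (key x)

end Ext

/-- The ring of scalars `ℤ[a_α]_{α ∈ κ} / Ann(M)`. -/
def ScalarRing : Type v :=
  MvPolynomial κ ℤ ⧸ Module.annihilator (MvPolynomial κ ℤ) (Ext M)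

namespace ScalarRing

noncomputable instance : CommRing (ScalarRing M) :=
  inferInstanceAs (CommRing (MvPolynomial κ ℤ ⧸ Module.annihilator (MvPolynomial κ ℤ) (Ext M)))

/-- The class of a polynomial. -/
noncomputable def mk : MvPolynomial κ ℤ →+* ScalarRing M :=
  Ideal.Quotient.mk (Module.annihilator (MvPolynomial κ ℤ) (Ext M))

noncomputable instance : Module (ScalarRing M) (Ext M) :=
  Module.quotientAnnihilator (R := MvPolynomial κ ℤ) (M := Ext M)

variable {M}

theorem mk_surjective : Function.Surjective (mk M) := Ideal.Quotient.mk_surjective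

theorem mk_smul (p : MvPolynomial κ ℤ) (z : Ext M) : mk M p • z = p • z := rfl

theorem smul_one_injective :
    Function.Injective fun r : ScalarRing M => r • Ext.of (1 : M) := by
  intro r r' h
  obtain ⟨p, rfl⟩ := mk_surjective r
  obtain ⟨q, rfl⟩ := mk_surjective r'
  refine Ideal.Quotient.eq.2 (Module.mem_annihilator.2 (Ext.poly_smul_eq_zero ?_))
  rw [sub_smul, sub_eq_zero]
  exact h

/-- The order of the ring of scalars, induced by the order of `M` via `r ↦ r • 1`. -/
noncomputable instance : LinearOrder (ScalarRing M) :=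
  LinearOrder.lift' (fun r : ScalarRing M => r • Ext.of (1 : M)) smul_one_injective

theorem le_iff {r r' : ScalarRing M} : r ≤ r' ↔ r • Ext.of (1 : M) ≤ r' • Ext.of (1 : M) := Iff.rfl

theorem pos_iff {r : ScalarRing M} : 0 < r ↔ 0 < r • Ext.of (1 : M) := by
  rw [← zero_smul (ScalarRing M) (Ext.of (1 : M))]
  exact Iff.rfl

theorem smul_pos' {r : ScalarRing M} {z : Ext M} (hr : 0 < r) (hz : 0 < z) : 0 < r • z := by
  rw [pos_iff] at hr
  obtain ⟨p, rfl⟩ := mk_surjective r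
  exact Ext.poly_smul_pos hr hz

instance : IsOrderedAddMonoid (ScalarRing M) where
  add_le_add_left r r' h s := by
    rw [le_iff, add_smul, add_smul]
    exact add_le_add_left (le_iff.1 h) _

instance : IsStrictOrderedRing (ScalarRing M) :=
  have : Nontrivial (ScalarRing M) := ⟨1, 0, fun h => by
    have h' := congrArg (fun r => r • Ext.of (1 : M)) h
    simp only [one_smul, zero_smul] at h'
    exact Ext.zero_lt_of_one.ne' h'⟩
  have : ZeroLEOneClass (ScalarRing M) := ⟨(pos_iff.2 (by
    rw [one_smul]; exact Ext.zero_lt_of_one)).le⟩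
  .of_mul_pos fun r s hr hs => pos_iff.2 (by rw [mul_smul]; exact smul_pos' hr (pos_iff.1 hs))

end ScalarRing

end Extension

/-! ### Discretely ordered modules as first-order structures -/

/-- Function symbols `0, +, -` and one unary symbol for every `r ∈ R`. -/
inductive ModFunc (R : Type v) : ℕ → Type v
  | zero : ModFunc R 0
  | add : ModFunc R 2
  | neg : ModFunc R 1
  | smul (r : R) : ModFunc R 1

/-- The language `⟨0, +, -, ≤, r⟩_{r ∈ R}` of ordered `R`-modules. -/
def ordModLang (R : Type v) : FirstOrder.Language.{v, 0} := ⟨ModFunc R, OrdRel⟩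

/-- An ordered module as a first-order structure. -/
instance ordModStructure {R : Type v} {A : Type u} [Ring R] [AddCommGroup A] [LE A] [Module R A] :
    (ordModLang R).Structure A where
  funMap {_} f := match f with
    | .zero => fun _ => 0
    | .add => fun x => x 0 + x 1
    | .neg => fun x => -x 0
    | .smul r => fun x => r • x 0
  RelMap {_} r := match r with
    | .le => fun x => x 0 ≤ x 1

/-- `A` is a discretely ordered module over the discretely ordered ring `R`. -/
structure IsDiscretelyOrderedModule (R : Type v) (A : Type u) [CommRing R] [LinearOrder R]
    [AddCommGroup A] [LinearOrder A] [Module R A] : Prop where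
  isStrictOrderedRing : IsStrictOrderedRing R
  ring_discrete : ∀ r : R, 0 < r → 1 ≤ r
  isOrderedAddMonoid : IsOrderedAddMonoid A
  smul_pos : ∀ (r : R) (x : A), 0 < r → 0 < x → 0 < r • x
  module_discrete : ∃ e : A, 0 < e ∧ ∀ x : A, 0 < x → e ≤ x

/-- The module of a model of linear arithmetic is a discretely ordered module over a discretely
ordered ring. -/
theorem ext_isDiscretelyOrderedModule {κ : Type v} (M : Type u) [LinStruct κ M] [IsLAModel M] :
    IsDiscretelyOrderedModule (ScalarRing M) (Ext M) where
  isStrictOrderedRing := inferInstance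
  ring_discrete r hr := by
    rw [ScalarRing.le_iff, one_smul]
    exact Ext.one_le_of_pos (ScalarRing.pos_iff.1 hr)
  isOrderedAddMonoid := inferInstance
  smul_pos _ _ := ScalarRing.smul_pos'
  module_discrete := ⟨Ext.of 1, Ext.zero_lt_of_one, fun _ => Ext.one_le_of_pos⟩

/-! ### The independence property -/

/-- A relation `R` on `X × Y` has the independence property if for every `n` there are `a i`,
`i < n`, and `b J`, `J ⊆ n`, such that `R (a i) (b J)` holds exactly when `i ∈ J`. -/
def HasIndependenceProperty {X : Type*} {Y : Type*} (R : X → Y → Prop) : Prop :=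
  ∀ n : ℕ, ∃ (a : Fin n → X) (b : Set (Fin n) → Y), ∀ i J, R (a i) (b J) ↔ i ∈ J

/-- A structure is NIP if no formula `φ(x, y)`, with tuples `x` and `y` of variables, has the
independence property in it. -/
def IsNIP (L : FirstOrder.Language) (A : Type*) [L.Structure A] : Prop :=
  ∀ (k l : ℕ) (φ : L.Formula (Fin k ⊕ Fin l)),
    ¬ HasIndependenceProperty fun (x : Fin k → A) (y : Fin l → A) => φ.Realize (Sum.elim x y)

/-! ### Partial multiplications -/

section Mult

variable {κ : Type v} {M : Type u} [LinStruct κ M]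

/-- `L` is non-standard: it is none of the elements `0, 1, 1 + 1, …`. -/
def IsNonstandard (L : M) : Prop := ∀ n : ℕ, L ≠ Nat.unaryCast n

/-- `mul` satisfies the recursive equations of a multiplication on `[0, L]²`; its values outside
of `[0, L]²` are irrelevant. -/
structure IsMulOn (L : M) (mul : M → M → M) : Prop where
  mul_zero : ∀ x, x ≤ L → mul x 0 = 0
  mul_succ : ∀ x y, x ≤ L → y + 1 ≤ L → mul x (y + 1) = mul x y + x

/-- The graph of the restriction of `mul` to `[0, L]²`. -/
def mulGraph (L : M) (mul : M → M → M) : Set (Fin 3 → M) :=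
  {v | v 0 ≤ L ∧ v 1 ≤ L ∧ v 2 = mul (v 0) (v 1)}

/-- The relation "`∃ z, 0 ≤ z ≤ y, z · x = y`" on the ordered module of `M`, where `·` is the
multiplication `mul` on `[0, L]²`. -/
def DivRel [IsLAModel M] (L : M) (mul : M → M → M) (x y : Ext M) : Prop :=
  ∃ z x' y' : M, x = Ext.of x' ∧ y = Ext.of y' ∧ z ≤ y' ∧ z ≤ L ∧ x' ≤ L ∧ mul z x' = y'

end Mult

end LinearArithmetic

/-!
The first part interprets the model in its module: `M` is the set of nonnegative elements of the
module and `1` is its least positive element, so every formula of linear arithmetic can be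
translated by bounding its quantifiers (`exists_module_formula`, `definable_image_of`). On standard
numbers the given multiplication is the true one by its recursive equations, so `DivRel` restricted
to them is divisibility (`divRel_iff_dvd`), which is independent as witnessed by primes and their
products. The parameters of the definition are finitely many and move into the second tuple of
variables (`not_isNIP_of_definable`).

For the existence of a model, let `N` vary over the natural numbers and take an ultraproduct of the
structures `⟨ℕ, 0, 1, +, ≤, a, b⟩` with scalars `a, b` depending on `N`. Each of them satisfies all
instances of induction, and so does the ultraproduct by the theorem of Łoś. It remains to find a
formula, independent of `N`, and scalars such that the formula defines the multiplication on
`[0, N]²` in the `N`-th factor (`exists_scalars`); then it defines the multiplication on `[0, L]²`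
in the ultraproduct for the non-standard `L` given by the diagonal sequence.

The coding is as follows. With `b = m + p a + n a²` for a large `a`, the base `a` digits of `b x`
make the multiplications of not too large `x` by `m`, `p` and `n` definable (`digits_iff`). So one
can define the denominators of the best approximations of `p / n`, which are the denominators of
the convergents of its continued fraction (`IsExpansion.isRecord_iff`). They satisfy a recursion
`q (i + 2) = c i * q (i + 1) + q i` with freely chosen partial quotients `c i`. Hence for every
finite list of residues coprime to a modulus there is a rational number `p / n` whose convergents
have exactly these residues and the residue `1` (`exists_records`). With the modulus `m ^ 4` for
`m` large in comparison with `N`, and the residues `1 + m x + m² y + m³ x y` for `x, y ≤ N`, the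
graph of the multiplication is read off from the base `m` digits of the convergents.
-/

namespace LinearArithmetic

open FirstOrder FirstOrder.Language FirstOrder.Language.Structure LinStruct

/-! ### Convergents with prescribed residues -/

theorem exists_mul_add_modEq {m u v e : ℕ} (hm : 0 < m) (hv : v.Coprime m) :
    ∃ c, 2 ≤ c ∧ c * v + u ≡ e [MOD m] := by
  obtain ⟨w, hw⟩ := Nat.exists_mul_mod_eq_of_coprime (e + (m * u - u)) hv hm.ne'
  -- the summand `2 * m` only serves to make the coefficient at least `2`
  refine ⟨w + 2 * m, by omega, ?_⟩
  have h1 : (v * w) ≡ e + (m * u - u) [MOD m] := hw.2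
  have h2 : v * w + u ≡ e + m * u [MOD m] := by
    have := h1.add_right u
    rwa [add_assoc, Nat.sub_add_cancel (Nat.le_mul_of_pos_left u hm)] at this
  have h3 : (w + 2 * m) * v + u = v * w + u + m * (2 * v) := by ring
  rw [h3]
  calc v * w + u + m * (2 * v) ≡ v * w + u [MOD m] := by simp [Nat.ModEq]
    _ ≡ e + m * u [MOD m] := h2
    _ ≡ e [MOD m] := by simp [Nat.ModEq]

/-- The denominators of a continued fraction can be given any residues coprime to the modulus:
the partial quotients `c i` are chosen one after the other. -/
theorem exists_denominators {m : ℕ} (hm : 0 < m) (e : ℕ → ℕ) (he : ∀ i, (e i).Coprime m) :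
    ∃ c q : ℕ → ℕ, q 0 = 0 ∧ q 1 = 1 ∧ (∀ i, 2 ≤ c i) ∧
      (∀ i, q (i + 2) = c i * q (i + 1) + q i) ∧ ∀ i, q (i + 2) ≡ e i [MOD m] := by
  classical
  have H : ∀ u v k, ∃ c, 2 ≤ c ∧ (v.Coprime m → c * v + u ≡ e k [MOD m]) := fun u v k => by
    by_cases hv : v.Coprime m
    · obtain ⟨c, hc, h⟩ := exists_mul_add_modEq (u := u) (e := e k) hm hv
      exact ⟨c, hc, fun _ => h⟩
    · exact ⟨2, le_rfl, fun h => absurd h hv⟩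
  choose f hf2 hf using H
  let s : ℕ → ℕ × ℕ := fun i =>
    Nat.rec (0, 1) (fun i r => (r.2, f r.1 r.2 i * r.2 + r.1)) i
  have hs : ∀ i, s (i + 1) = ((s i).2, f (s i).1 (s i).2 i * (s i).2 + (s i).1) := fun _ => rfl
  have hcop : ∀ i, (s i).2.Coprime m := by
    intro i
    induction i with
    | zero => exact Nat.coprime_one_left m
    | succ i ih =>
      have h : (s (i + 1)).2 ≡ e i [MOD m] := hf _ _ _ ih
      rw [Nat.Coprime, h.gcd_eq]
      exact he i
  exact ⟨fun i => f (s i).1 (s i).2 i, fun i => (s i).1, rfl, rfl, fun i => hf2 _ _ _,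
    fun i => rfl, fun i => hf _ _ _ (hcop i)⟩

/-- The remainders of the continued fraction with the partial quotients `c`, computed backwards
from the end. -/
theorem exists_remainders (c : ℕ → ℕ) (K : ℕ) :
    ∃ d : ℕ → ℕ, d (K + 1) = 0 ∧ d K = 1 ∧ ∀ i, i < K → d i = c i * d (i + 1) + d (i + 2) := by
  induction K generalizing c with
  | zero => exact ⟨fun i => 1 - i, rfl, rfl, fun i hi => absurd hi (Nat.not_lt_zero i)⟩
  | succ K ih =>
    obtain ⟨d, h0, h1, hd⟩ := ih fun i => c (i + 1)
    refine ⟨fun i => Nat.casesOn i (c 0 * d 0 + d 1) d, h0, h1, fun i hi => ?_⟩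
    cases i with
    | zero => rfl
    | succ i => exact hd i (by omega)

/-- `y` is the distance of `p x` from some multiple `n z` with `z ≤ x`. -/
def IsDist (p n x y : ℕ) : Prop := ∃ z, z ≤ x ∧ (p * x + y = n * z ∨ n * z + y = p * x)

/-- `x` is the denominator of a best approximation of `p / n`: some distance of `p x` from a
multiple of `n` is smaller than all the distances for smaller positive arguments. -/
def IsRecord (p n x : ℕ) : Prop :=
  1 ≤ x ∧ ∃ y, IsDist p n x y ∧ ∀ x' y', 1 ≤ x' → x' + 1 ≤ x → IsDist p n x' y' → y + 1 ≤ y'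

/-- The denominators `q` and the remainders `d` of the continued fraction expansion of
`d 1 / d 0` with partial quotients `c i`. -/
structure IsExpansion (K : ℕ) (c q d : ℕ → ℕ) : Prop where
  q_zero : q 0 = 0
  q_one : q 1 = 1
  two_le : ∀ i, 2 ≤ c i
  q_rec : ∀ i, q (i + 2) = c i * q (i + 1) + q i
  d_last : d (K + 1) = 0
  d_prev : d K = 1
  d_rec : ∀ i, i < K → d i = c i * d (i + 1) + d (i + 2)

namespace IsExpansion

variable {K : ℕ} {c q d : ℕ → ℕ} (h : IsExpansion K c q d)
include h

theorem q_lt_succ (i : ℕ) : q i < q (i + 1) := by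
  induction i with
  | zero => rw [h.q_zero, h.q_one]; exact Nat.one_pos
  | succ i ih =>
    have := Nat.mul_le_mul_right (q (i + 1)) (h.two_le i)
    rw [h.q_rec]
    omega

theorem q_strictMono : StrictMono q := strictMono_nat_of_lt_succ h.q_lt_succ

theorem d_succ_lt {i : ℕ} (hi : i ≤ K) : d (i + 1) < d i := by
  induction hk : K - i generalizing i with
  | zero =>
    obtain rfl : i = K := by omega
    rw [h.d_last, h.d_prev]
    exact Nat.one_pos
  | succ k ih =>
    have := ih (i := i + 1) (by omega) (by omega)
    have := Nat.mul_le_mul_right (d (i + 1)) (h.two_le i)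
    rw [h.d_rec i (by omega)]
    omega

theorem q_mul_d_add {i : ℕ} (hi : i ≤ K) : q (i + 1) * d i + q i * d (i + 1) = d 0 := by
  induction i with
  | zero => rw [h.q_zero, h.q_one]; ring
  | succ i ih =>
    rw [← ih (by omega), h.q_rec, h.d_rec i (by omega)]
    ring

theorem q_last : q (K + 1) = d 0 := by
  have := h.q_mul_d_add le_rfl
  rwa [h.d_last, h.d_prev, mul_one, mul_zero, add_zero] at this

/-- Consecutive pairs `(q i, ± d i)` are bases of the lattice of all `(x, p x - n z)`. -/
theorem exists_coords (x z : ℤ) {i : ℕ} (hi : i ≤ K) : ∃ s t : ℤ, x = s * q i + t * q (i + 1) ∧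
    |(d 1 : ℤ) * x - d 0 * z| = |s * d i - t * d (i + 1)| := by
  induction i with
  | zero =>
    refine ⟨z, x, by rw [h.q_zero, h.q_one]; push_cast; ring, ?_⟩
    rw [abs_sub_comm]
    congr 1
    ring
  | succ i ih =>
    obtain ⟨s, t, h1, h2⟩ := ih (by omega)
    refine ⟨t - c i * s, s, ?_, ?_⟩
    · rw [h1, h.q_rec]; push_cast; ring
    · rw [h2, h.d_rec i (by omega), ← abs_neg]
      congr 1
      push_cast; ring

/-- The law of best approximation. -/
theorem d_le_abs {x z : ℤ} {i : ℕ} (hi : i ≤ K) (h0 : 0 < x) (hx : x < q (i + 1)) :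
    (d i : ℤ) ≤ |(d 1 : ℤ) * x - d 0 * z| := by
  obtain ⟨s, t, h1, h2⟩ := h.exists_coords x z hi
  rw [h2]
  have hq : (0 : ℤ) ≤ q i := Int.natCast_nonneg _
  have hq' : (0 : ℤ) ≤ q (i + 1) := Int.natCast_nonneg _
  have hd : (0 : ℤ) ≤ d i := Int.natCast_nonneg _
  have hd' : (0 : ℤ) ≤ d (i + 1) := Int.natCast_nonneg _
  -- the coordinates `s` and `t` have opposite signs, so nothing cancels in `s d i - t d (i + 1)`
  rcases lt_or_ge 0 t with ht | ht
  · have hs : s < 0 := by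
      by_contra! hs
      nlinarith [mul_nonneg hs hq]
    exact le_trans (by nlinarith) (neg_le_abs _)
  · have hs : 0 < s := by
      by_contra! hs
      nlinarith
    exact le_trans (by nlinarith) (le_abs_self _)

theorem d_le_of_isDist {x y i : ℕ} (hi : i ≤ K) (h0 : 1 ≤ x) (hx : x < q (i + 1))
    (hy : IsDist (d 1) (d 0) x y) : d i ≤ y := by
  obtain ⟨z, -, hz⟩ := hy
  have := h.d_le_abs (x := x) (z := z) hi (by exact_mod_cast h0) (by exact_mod_cast hx)
  have hy : |(d 1 : ℤ) * x - d 0 * z| = y := by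
    rcases hz with hz | hz
    · have : (d 1 : ℤ) * x + y = d 0 * z := by exact_mod_cast hz
      rw [← this, sub_add_cancel_left, abs_neg, Nat.abs_cast]
    · have : (d 0 : ℤ) * z + y = d 1 * x := by exact_mod_cast hz
      rw [← this, add_sub_cancel_left, Nat.abs_cast]
  rw [hy] at this
  exact_mod_cast this

/-- The numerators `z`, `z'` of two consecutive convergents; the signs of the remainders
alternate. -/
theorem exists_numerators {i : ℕ} (hi : i ≤ K) : ∃ z z' : ℕ,
    (i = 0 → z = 1 ∧ z' = 0) ∧ (1 ≤ i → z ≤ q i) ∧ z' ≤ q (i + 1) ∧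
    ((d 0 * z = d 1 * q i + d i ∧ d 0 * z' + d (i + 1) = d 1 * q (i + 1)) ∨
      (d 0 * z + d i = d 1 * q i ∧ d 0 * z' = d 1 * q (i + 1) + d (i + 1))) := by
  induction i with
  | zero =>
    exact ⟨1, 0, fun _ => ⟨rfl, rfl⟩, fun h0 => absurd h0 (by norm_num), Nat.zero_le _,
      .inl ⟨by rw [h.q_zero]; ring, by rw [h.q_one]; ring⟩⟩
  | succ i ih =>
    obtain ⟨z, z', h0, h1, h2, h3⟩ := ih (by omega)
    have hd := h.d_rec i (by omega)
    refine ⟨z', c i * z' + z, fun hi0 => absurd hi0 i.succ_ne_zero, fun _ => h2, ?_, ?_⟩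
    · rw [h.q_rec]
      rcases Nat.eq_zero_or_pos i with rfl | hi0
      · obtain ⟨rfl, rfl⟩ := h0 rfl
        have := h.two_le 0
        rw [h.q_one]
        omega
      · exact Nat.add_le_add (Nat.mul_le_mul_left _ h2) (h1 hi0)
    · rcases h3 with ⟨h3, h4⟩ | ⟨h3, h4⟩
      · refine .inr ⟨h4, ?_⟩
        rw [h.q_rec]
        zify at h3 h4 hd ⊢
        linear_combination c i * h4 + h3 + hd
      · refine .inl ⟨h4, ?_⟩
        rw [h.q_rec]
        zify at h3 h4 hd ⊢
        linear_combination c i * h4 + h3 - hd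

theorem isDist_q {i : ℕ} (h1 : 1 ≤ i) (hi : i ≤ K + 1) : IsDist (d 1) (d 0) (q i) (d i) := by
  obtain ⟨j, rfl⟩ := Nat.exists_eq_add_of_le' h1
  obtain ⟨_, z', -, -, hz, h3⟩ := h.exists_numerators (i := j) (by omega)
  exact ⟨z', hz, by rcases h3 with ⟨-, h3⟩ | ⟨-, h3⟩ <;> omega⟩

/-- The best approximations of `d 1 / d 0` are exactly its convergents. -/
theorem isRecord_iff {x : ℕ} : IsRecord (d 1) (d 0) x ↔ ∃ i, 1 ≤ i ∧ i ≤ K + 1 ∧ x = q i := by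
  constructor
  · rintro ⟨hx, y, hy, hmin⟩
    have hxn : x ≤ q (K + 1) := by
      by_contra! hlt
      have := hmin _ _ (by have := h.q_strictMono.le_apply (x := K + 1); omega) hlt
        (h.isDist_q (by omega) le_rfl)
      rw [h.d_last] at this
      omega
    have hex : ∃ i, x ≤ q i := ⟨_, hxn⟩
    classical
    obtain ⟨i, hi, hlt⟩ : ∃ i, x ≤ q i ∧ ∀ j < i, q j < x :=
      ⟨Nat.find hex, Nat.find_spec hex, fun j hj => not_le.1 (Nat.find_min hex hj)⟩
    have hiK : i ≤ K + 1 := by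
      by_contra! hlt'
      have := hlt _ hlt'
      omega
    have hi1 : 1 ≤ i := by
      by_contra! h0
      obtain rfl : i = 0 := by omega
      rw [h.q_zero] at hi
      omega
    refine ⟨i, hi1, hiK, hi.antisymm ?_⟩
    by_contra! hxq
    obtain ⟨j, rfl⟩ := Nat.exists_eq_add_of_le' hi1
    have hj1 : 1 ≤ j := by
      by_contra! h0
      obtain rfl : j = 0 := by omega
      rw [zero_add, h.q_one] at hxq
      omega
    have hj := hlt j (by omega)
    have h1 := h.d_le_of_isDist (by omega) hx hxq hy
    have h2 := hmin _ _ (by have := h.q_strictMono.le_apply (x := j); omega) hj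
      (h.isDist_q hj1 (by omega))
    omega
  · rintro ⟨i, hi1, hiK, rfl⟩
    obtain ⟨j, rfl⟩ := Nat.exists_eq_add_of_le' hi1
    refine ⟨by have := h.q_strictMono.le_apply (x := j + 1); omega, d (j + 1),
      h.isDist_q hi1 hiK, fun x' y' h1 hlt hy' => ?_⟩
    have h1 := h.d_le_of_isDist (i := j) (by omega) h1 hlt hy'
    have h2 := h.d_succ_lt (i := j) (by omega)
    omega

end IsExpansion

/-- Any finite list of residues coprime to the modulus is the set of residues of the denominators
of the best approximations of a suitable rational number, up to the additional residue `1`. -/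
theorem exists_records {m : ℕ} (hm : 0 < m) (e : ℕ → ℕ) (he : ∀ i, (e i).Coprime m) (K : ℕ) :
    ∃ p n : ℕ, IsRecord p n n ∧ IsDist p n n 0 ∧
      (∀ x, IsRecord p n x → x ≡ 1 [MOD m] ∨ ∃ i < K, x ≡ e i [MOD m]) ∧
      ∀ i < K, ∃ x, IsRecord p n x ∧ x ≡ e i [MOD m] := by
  obtain ⟨c, q, q0, q1, hc, hq, hqe⟩ := exists_denominators hm e he
  obtain ⟨d, d0, d1, hd⟩ := exists_remainders c K
  have h : IsExpansion K c q d := ⟨q0, q1, hc, hq, d0, d1, hd⟩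
  refine ⟨d 1, d 0, h.isRecord_iff.2 ⟨K + 1, by omega, le_rfl, h.q_last.symm⟩, ?_,
    fun x hx => ?_, fun i hi => ?_⟩
  · have := h.isDist_q (i := K + 1) (by omega) le_rfl
    rwa [h.q_last, h.d_last] at this
  · obtain ⟨i, h1, hi, rfl⟩ := h.isRecord_iff.1 hx
    obtain rfl | h2 := h1.eq_or_lt
    · exact .inl (by rw [q1])
    · obtain ⟨j, rfl⟩ := Nat.exists_eq_add_of_le' h2
      exact .inr ⟨j, by omega, hqe j⟩
  · exact ⟨q (i + 2), h.isRecord_iff.2 ⟨i + 2, by omega, by omega, rfl⟩, hqe i⟩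

/-! ### The formula defining the multiplication -/

section Formula

variable {M : Type*} [LinStruct (Fin 2) M]

/-- With `a` the first and `b` the second scalar, `b x = u + a v + a² w` where `u, v < a`. -/
def Digits (x u v w : M) : Prop :=
  scalar 1 x = u + scalar 0 (v + scalar 0 w) ∧ u + 1 ≤ scalar 0 (1 : M) ∧
    v + 1 ≤ scalar 0 (1 : M)

/-- The counterpart of `IsDist` in the language of linear arithmetic. -/
def LinDist (x y : M) : Prop :=
  ∃ z u v w u' v' w' : M, z ≤ x ∧ Digits x u v w ∧ Digits z u' v' w' ∧
    (v + y = w' ∨ w' + y = v)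

/-- The counterpart of `IsRecord` in the language of linear arithmetic. -/
def LinRecord (x : M) : Prop :=
  1 ≤ x ∧ ∃ y : M, LinDist x y ∧
    ∀ x' y' : M, 1 ≤ x' → x' + 1 ≤ x → LinDist x' y' → y + 1 ≤ y'

/-- The lowest of the digits of `b x`. -/
def LowDigit (x u : M) : Prop := ∃ v w : M, Digits x u v w

/-- With `m` the lowest digit of `b`, some record `1 + m x + m² y + m³ z + m⁴ t` has the digits
`x, y, z < m`. -/
def LinMul (x y z : M) : Prop :=
  ∃ r s₁ s₂ s₃ t u₁ u₂ u₃ u₄ m : M, LinRecord r ∧ LowDigit 1 m ∧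
    (x + 1 ≤ m ∧ y + 1 ≤ m ∧ z + 1 ≤ m) ∧ (s₁ ≤ r ∧ s₂ ≤ r ∧ s₃ ≤ r ∧ t ≤ r) ∧
    (LowDigit s₁ u₁ ∧ r = u₁ + 1) ∧ (LowDigit s₂ u₂ ∧ s₁ = x + u₂) ∧
    (LowDigit s₃ u₃ ∧ s₂ = y + u₃) ∧ (LowDigit t u₄ ∧ s₃ = z + u₄)

variable {α : Type}

/-- The formula `Digits x u v w`. -/
def fDigits (x u v w : (linLang (Fin 2)).Term α) : (linLang (Fin 2)).Formula α :=
  Term.equal (tScalar 1 x) (tAdd u (tScalar 0 (tAdd v (tScalar 0 w)))) ⊓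
    (fLe (tAdd u tOne) (tScalar 0 tOne) ⊓ fLe (tAdd v tOne) (tScalar 0 tOne))

theorem realize_fDigits (e : α → M) (x u v w : (linLang (Fin 2)).Term α) :
    (fDigits x u v w).Realize e ↔
      Digits (x.realize e) (u.realize e) (v.realize e) (w.realize e) := by
  simp [fDigits, Digits]

/-- A term, considered in a context with `k` additional variables. -/
def tLift (k : ℕ) (x : (linLang (Fin 2)).Term α) : (linLang (Fin 2)).Term (α ⊕ Fin k) :=
  x.relabel Sum.inl

theorem realize_tLift {k : ℕ} (e : α → M) (i : Fin k → M) (x : (linLang (Fin 2)).Term α) :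
    (tLift k x).realize (Sum.elim e i) = x.realize e := by
  simp [tLift]

/-- The `j`-th of `k` additional variables. -/
def tNew {k : ℕ} (j : Fin k) : (linLang (Fin 2)).Term (α ⊕ Fin k) := .var (.inr j)

theorem realize_tNew {k : ℕ} (e : α → M) (i : Fin k → M) (j : Fin k) :
    (tNew j : (linLang (Fin 2)).Term (α ⊕ Fin k)).realize (Sum.elim e i) = i j := rfl

/-- The formula `LinDist x y`. -/
noncomputable def fLinDist (x y : (linLang (Fin 2)).Term α) : (linLang (Fin 2)).Formula α :=
  Formula.iExs (Fin 7) <| fLe (tNew 0) (tLift 7 x) ⊓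
    (fDigits (tLift 7 x) (tNew 1) (tNew 2) (tNew 3) ⊓
    (fDigits (tNew 0) (tNew 4) (tNew 5) (tNew 6) ⊓
    (Term.equal (tAdd (tNew 2) (tLift 7 y)) (tNew 6) ⊔
      Term.equal (tAdd (tNew 6) (tLift 7 y)) (tNew 2))))

theorem realize_fLinDist (e : α → M) (x y : (linLang (Fin 2)).Term α) :
    (fLinDist x y).Realize e ↔ LinDist (x.realize e) (y.realize e) := by
  simp only [fLinDist, LinDist, Formula.realize_iExs, Formula.realize_inf, Formula.realize_sup,
    realize_fLe, realize_fDigits, Formula.realize_equal, realize_tAdd, realize_tLift, realize_tNew]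
  exact ⟨fun ⟨i, h⟩ => ⟨i 0, i 1, i 2, i 3, i 4, i 5, i 6, h⟩,
    fun ⟨z, u, v, w, u', v', w', h⟩ => ⟨![z, u, v, w, u', v', w'], h⟩⟩

/-- The formula `LinRecord x`. -/
noncomputable def fLinRecord (x : (linLang (Fin 2)).Term α) : (linLang (Fin 2)).Formula α :=
  fLe tOne x ⊓ Formula.iExs (Fin 1) (fLinDist (tLift 1 x) (tNew 0) ⊓
    Formula.iAlls (Fin 2) ((fLe tOne (tNew 0)).imp
      ((fLe (tAdd (tNew 0) tOne) (tLift 2 (tLift 1 x))).imp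
      ((fLinDist (tNew 0) (tNew 1)).imp (fLe (tAdd (tLift 2 (tNew 0)) tOne) (tNew 1))))))

theorem realize_fLinRecord (e : α → M) (x : (linLang (Fin 2)).Term α) :
    (fLinRecord x).Realize e ↔ LinRecord (x.realize e) := by
  simp only [fLinRecord, LinRecord, Formula.realize_iExs, Formula.realize_iAlls,
    Formula.realize_inf, Formula.realize_imp, realize_fLe, realize_fLinDist, realize_tAdd,
    realize_tOne, realize_tLift, realize_tNew]
  refine and_congr_right fun _ => ⟨fun ⟨i, h, h'⟩ => ⟨i 0, h, fun x' y' => h' ![x', y']⟩,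
    fun ⟨y, h, h'⟩ => ⟨![y], h, fun i => h' (i 0) (i 1)⟩⟩

/-- The formula `LowDigit x u`. -/
noncomputable def fLowDigit (x u : (linLang (Fin 2)).Term α) : (linLang (Fin 2)).Formula α :=
  Formula.iExs (Fin 2) (fDigits (tLift 2 x) (tLift 2 u) (tNew 0) (tNew 1))

theorem realize_fLowDigit (e : α → M) (x u : (linLang (Fin 2)).Term α) :
    (fLowDigit x u).Realize e ↔ LowDigit (x.realize e) (u.realize e) := by
  simp only [fLowDigit, LowDigit, Formula.realize_iExs, realize_fDigits, realize_tLift,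
    realize_tNew]
  exact ⟨fun ⟨i, h⟩ => ⟨i 0, i 1, h⟩, fun ⟨v, w, h⟩ => ⟨![v, w], h⟩⟩

/-- The formula `LinMul x y z`. -/
noncomputable def fLinMul : (linLang (Fin 2)).Formula (Fin 3) :=
  Formula.iExs (Fin 10) <| fLinRecord (tNew 0) ⊓ (fLowDigit tOne (tNew 9) ⊓
    ((fLe (tAdd (tLift 10 (.var 0)) tOne) (tNew 9) ⊓
      (fLe (tAdd (tLift 10 (.var 1)) tOne) (tNew 9) ⊓
      fLe (tAdd (tLift 10 (.var 2)) tOne) (tNew 9))) ⊓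
    ((fLe (tNew 1) (tNew 0) ⊓ (fLe (tNew 2) (tNew 0) ⊓
      (fLe (tNew 3) (tNew 0) ⊓ fLe (tNew 4) (tNew 0)))) ⊓
    ((fLowDigit (tNew 1) (tNew 5) ⊓ Term.equal (tNew 0) (tAdd (tNew 5) tOne)) ⊓
    ((fLowDigit (tNew 2) (tNew 6) ⊓ Term.equal (tNew 1) (tAdd (tLift 10 (.var 0)) (tNew 6))) ⊓
    ((fLowDigit (tNew 3) (tNew 7) ⊓ Term.equal (tNew 2) (tAdd (tLift 10 (.var 1)) (tNew 7))) ⊓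
    (fLowDigit (tNew 4) (tNew 8) ⊓
      Term.equal (tNew 3) (tAdd (tLift 10 (.var 2)) (tNew 8)))))))))

theorem realize_fLinMul (e : Fin 3 → M) : fLinMul.Realize e ↔ LinMul (e 0) (e 1) (e 2) := by
  simp only [fLinMul, LinMul, Formula.realize_iExs, Formula.realize_inf, realize_fLe,
    realize_fLowDigit, realize_fLinRecord, Formula.realize_equal, realize_tAdd, realize_tOne,
    realize_tLift, realize_tNew, Term.realize_var]
  exact ⟨fun ⟨i, h⟩ => ⟨i 0, i 1, i 2, i 3, i 4, i 5, i 6, i 7, i 8, i 9, h⟩,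
    fun ⟨r, s₁, s₂, s₃, t, u₁, u₂, u₃, u₄, m, h⟩ =>
      ⟨![r, s₁, s₂, s₃, t, u₁, u₂, u₃, u₄, m], h⟩⟩

end Formula

/-! ### The formula in the natural numbers -/

/-- The natural numbers with two scalars `c 0` and `c 1`. -/
def ScaledNat (_ : Fin 2 → ℕ) : Type := ℕ

instance (c : Fin 2 → ℕ) : LinStruct (Fin 2) (ScaledNat c) where
  zero := (0 : ℕ)
  one := (1 : ℕ)
  add x y := (Nat.add x y : ℕ)
  le x y := Nat.le x y
  scalar i x := (Nat.mul (c i) x : ℕ)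

/-- The scalars `a` and `m + p a + n a²`, where `a` exceeds the products of `m` and `p` with
numbers up to `n`. -/
def codeScalars (m p n : ℕ) : Fin 2 → ℕ :=
  ![(m + p) * n + 1, m + ((m + p) * n + 1) * (p + ((m + p) * n + 1) * n)]

section Nat

variable {m p n : ℕ}

theorem digits_iff_aux {A x u v w : ℕ} (h1 : m * x < A) (h2 : p * x < A) :
    ((m + A * (p + A * n)) * x = u + A * (v + A * w) ∧ u + 1 ≤ A ∧ v + 1 ≤ A) ↔
      u = m * x ∧ v = p * x ∧ w = n * x := by
  have hA : 0 < A := by omega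
  have key : (m + A * (p + A * n)) * x = m * x + A * (p * x + A * (n * x)) := by ring
  rw [key]
  constructor
  · rintro ⟨h, hu, hv⟩
    have hu' : m * x = u := by
      have := congrArg (· % A) h
      simpa [Nat.add_mul_mod_self_left, Nat.mod_eq_of_lt h1, Nat.mod_eq_of_lt hu] using this
    rw [hu', Nat.add_left_cancel_iff] at h
    have h' := Nat.eq_of_mul_eq_mul_left hA h
    have hv' : p * x = v := by
      have := congrArg (· % A) h'
      simpa [Nat.add_mul_mod_self_left, Nat.mod_eq_of_lt h2, Nat.mod_eq_of_lt hv] using this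
    rw [hv', Nat.add_left_cancel_iff] at h'
    exact ⟨hu'.symm, hv'.symm, (Nat.eq_of_mul_eq_mul_left hA h').symm⟩
  · rintro ⟨rfl, rfl, rfl⟩
    exact ⟨rfl, h1, h2⟩

/-- In the natural numbers the digits of `b x` are `m x`, `p x` and `n x`, if `x ≤ n`. -/
theorem digits_iff {x u v w : ℕ} (hx : x ≤ n) :
    Digits (M := ScaledNat (codeScalars m p n)) x u v w ↔
      u = m * x ∧ v = p * x ∧ w = n * x := by
  have h1 := Nat.mul_le_mul_left m hx
  have h2 := Nat.mul_le_mul_left p hx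
  have h3 : (m + p) * n = m * n + p * n := by ring
  rw [← digits_iff_aux (m := m) (p := p) (n := n) (A := (m + p) * n + 1) (by omega) (by omega)]
  change (codeScalars m p n 1 * x = u + codeScalars m p n 0 * (v + codeScalars m p n 0 * w) ∧
    u + 1 ≤ codeScalars m p n 0 * 1 ∧ v + 1 ≤ codeScalars m p n 0 * 1) ↔ _
  rw [mul_one]
  exact Iff.rfl

theorem lowDigit_iff {x u : ℕ} (hx : x ≤ n) :
    LowDigit (M := ScaledNat (codeScalars m p n)) x u ↔ u = m * x :=
  ⟨fun ⟨_, _, h⟩ => ((digits_iff hx).1 h).1,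
    fun h => ⟨p * x, n * x, (digits_iff hx).2 ⟨h, rfl, rfl⟩⟩⟩

theorem linDist_iff {x y : ℕ} (hx : x ≤ n) :
    LinDist (M := ScaledNat (codeScalars m p n)) x y ↔ IsDist p n x y := by
  constructor
  · rintro ⟨z, u, v, w, u', v', w', hz, h, h', hy⟩
    obtain ⟨-, rfl, -⟩ := (digits_iff hx).1 h
    obtain ⟨-, -, rfl⟩ := (digits_iff (le_trans (α := ℕ) hz hx)).1 h'
    exact ⟨z, hz, hy⟩
  · rintro ⟨z, hz, hy⟩
    exact ⟨z, m * x, p * x, n * x, m * z, p * z, n * z, hz, (digits_iff hx).2 ⟨rfl, rfl, rfl⟩,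
      (digits_iff (hz.trans hx)).2 ⟨rfl, rfl, rfl⟩, hy⟩

theorem linRecord_iff (hn : 1 ≤ n) (h : IsDist p n n 0) {x : ℕ} :
    LinRecord (M := ScaledNat (codeScalars m p n)) x ↔ IsRecord p n x := by
  -- a record exceeding `n` would have to have a distance smaller than `0`
  constructor
  · rintro ⟨h1, y, hy, hmin⟩
    have hx : x ≤ n := by
      by_contra! hlt
      exact absurd (hmin n (0 : ℕ) hn hlt ((linDist_iff le_rfl).2 h)) (Nat.not_succ_le_zero y)
    exact ⟨h1, y, (linDist_iff hx).1 hy, fun x' y' h1' hlt hy' =>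
      hmin x' y' h1' hlt ((linDist_iff ((Nat.le_of_lt hlt).trans hx)).2 hy')⟩
  · rintro ⟨h1, y, hy, hmin⟩
    have hx : x ≤ n := by
      by_contra! hlt
      exact absurd (hmin n 0 hn hlt h) (Nat.not_succ_le_zero y)
    exact ⟨h1, y, (linDist_iff hx).2 hy, fun x' y' h1' hlt hy' =>
      hmin x' y' h1' hlt ((linDist_iff ((Nat.le_of_lt hlt).trans hx)).1 hy')⟩

/-- The bounds `s₁, s₂, s₃, t ≤ r` in `LinMul` keep all arguments below `n`, where the digits of
multiples of `b` are the expected ones. -/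
theorem linMul_iff (hm : 1 ≤ m) (hn : 1 ≤ n) (h : IsDist p n n 0) {x y z : ℕ} :
    LinMul (M := ScaledNat (codeScalars m p n)) x y z ↔
      x < m ∧ y < m ∧ z < m ∧
        ∃ t, IsRecord p n (1 + m * (x + m * (y + m * (z + m * t)))) := by
  have hle : ∀ {r}, IsRecord p n r → r ≤ n := fun {r} ⟨_, y, _, hmin⟩ => by
    by_contra! hlt
    exact absurd (hmin n 0 hn hlt h) (Nat.not_succ_le_zero y)
  constructor
  · rintro ⟨(r : ℕ), (s₁ : ℕ), (s₂ : ℕ), (s₃ : ℕ), (t : ℕ), u₁, u₂, u₃, u₄, m', hr, hm',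
      ⟨hx, hy, hz⟩, ⟨h1, h2, h3, h4⟩,
      ⟨h5, h5'⟩, ⟨h6, h6'⟩, ⟨h7, h7'⟩, ⟨h8, h8'⟩⟩
    have hr' := (linRecord_iff hn h).1 hr
    have hrn := hle hr'
    obtain rfl := (lowDigit_iff (x := 1) hn).1 hm'
    obtain rfl := (lowDigit_iff (le_trans (α := ℕ) h1 hrn)).1 h5
    obtain rfl := (lowDigit_iff (le_trans (α := ℕ) h2 hrn)).1 h6
    obtain rfl := (lowDigit_iff (le_trans (α := ℕ) h3 hrn)).1 h7
    obtain rfl := (lowDigit_iff (le_trans (α := ℕ) h4 hrn)).1 h8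
    change x + 1 ≤ m * 1 at hx
    change y + 1 ≤ m * 1 at hy
    change z + 1 ≤ m * 1 at hz
    change (r : ℕ) = m * s₁ + 1 at h5'
    change (s₁ : ℕ) = x + m * s₂ at h6'
    change (s₂ : ℕ) = y + m * s₃ at h7'
    change (s₃ : ℕ) = z + m * t at h8'
    refine ⟨by omega, by omega, by omega, t, ?_⟩
    rw [add_comm 1]
    convert hr'
    rw [h5', h6', h7', h8']
  · rintro ⟨hx, hy, hz, t, hr⟩
    have hrn := hle hr
    set s₃ := z + m * t with h3
    set s₂ := y + m * s₃ with h2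
    set s₁ := x + m * s₂ with h1
    set r := 1 + m * s₁ with h0
    have e0 := Nat.le_mul_of_pos_left s₁ hm
    have e1 := Nat.le_mul_of_pos_left s₂ hm
    have e2 := Nat.le_mul_of_pos_left s₃ hm
    have e3 := Nat.le_mul_of_pos_left t hm
    have l1 : s₁ ≤ r := by omega
    have l2 : s₂ ≤ r := by omega
    have l3 : s₃ ≤ r := by omega
    have l4 : t ≤ r := by omega
    refine ⟨r, s₁, s₂, s₃, t, m * s₁, m * s₂, m * s₃, m * t, m, (linRecord_iff hn h).2 hr,
      (lowDigit_iff (x := 1) hn).2 (mul_one m).symm, ⟨hx, hy, hz⟩, ⟨l1, l2, l3, l4⟩,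
      ⟨(lowDigit_iff (l1.trans hrn)).2 rfl, Nat.add_comm _ _⟩,
      ⟨(lowDigit_iff (l2.trans hrn)).2 rfl, rfl⟩,
      ⟨(lowDigit_iff (l3.trans hrn)).2 rfl, rfl⟩, ⟨(lowDigit_iff (l4.trans hrn)).2 rfl, rfl⟩⟩

end Nat

/-- The base `m` digits `x, y, z` of `1 + m x + m² y + m³ z` are determined by its residue modulo
`m ^ 4`. -/
theorem digits_unique {m x y z t x' y' z' : ℕ} (hx : x < m) (hy : y < m) (hz : z < m)
    (hx' : x' < m) (hy' : y' < m) (hz' : z' < m)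
    (h : 1 + m * (x + m * (y + m * (z + m * t))) ≡ 1 + m * (x' + m * (y' + m * z')) [MOD m ^ 4]) :
    x = x' ∧ y = y' ∧ z = z' := by
  have hm : m ≠ 0 := by omega
  have h1 := Nat.ModEq.add_left_cancel' 1 h
  rw [show m ^ 4 = m * (m * (m * m)) by ring] at h1
  have h2 := Nat.ModEq.mul_left_cancel' hm h1
  have step : ∀ {a b c d k : ℕ}, a < m → b < m → a + m * c ≡ b + m * d [MOD m * k] →
      a = b ∧ c ≡ d [MOD k] := by
    intro a b c d k ha hb hab
    have h0 : a = b := by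
      have := hab.of_mul_right k
      simpa [Nat.ModEq, Nat.mod_eq_of_lt ha, Nat.mod_eq_of_lt hb] using this
    subst h0
    exact ⟨rfl, Nat.ModEq.mul_left_cancel' hm (Nat.ModEq.add_left_cancel' a hab)⟩
  obtain ⟨h3, h4⟩ := step hx hx' h2
  obtain ⟨h5, h6⟩ := step hy hy' h4
  refine ⟨h3, h5, ?_⟩
  simpa [Nat.ModEq, Nat.mod_eq_of_lt hz, Nat.mod_eq_of_lt hz'] using h6

/-- For every `N` there are two scalars such that one and the same formula defines the
multiplication on `[0, N]²`. -/
theorem exists_scalars (N : ℕ) : ∃ c : Fin 2 → ℕ, ∀ x y z : ℕ,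
    LinMul (M := ScaledNat c) x y z ↔ x ≤ N ∧ y ≤ N ∧ z = x * y := by
  set m := N * N + N + 2 with hm
  -- the `i`-th residue codes the triple `(x, y, x y)` for `i = x + (N + 1) y`; it is coprime to
  -- the modulus because it is `1` modulo `m`
  let e : ℕ → ℕ := fun i =>
    1 + m * (i % (N + 1) + m * (i / (N + 1) + m * (i % (N + 1) * (i / (N + 1)))))
  have he : ∀ i, (e i).Coprime (m ^ 4) := fun i => by
    refine Nat.Coprime.pow_right 4 ?_
    rw [Nat.coprime_comm]
    simp [e]
  obtain ⟨p, n, hn, hdist, h1, h2⟩ :=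
    exists_records (m := m ^ 4) (by positivity) e he ((N + 1) * (N + 1))
  have hlt : ∀ {x y}, x ≤ N → y ≤ N → x < m ∧ y < m ∧ x * y < m := fun hx hy => by
    have := Nat.mul_le_mul hx hy
    omega
  refine ⟨codeScalars m p n, fun x y z => ?_⟩
  rw [linMul_iff (by omega) hn.1 hdist]
  constructor
  · rintro ⟨hx, hy, hz, t, hr⟩
    obtain hr | ⟨i, hi, hr⟩ := h1 _ hr
    · -- the residue `1` of the first convergent codes `0 * 0 = 0`
      obtain ⟨rfl, rfl, rfl⟩ := digits_unique (x' := 0) (y' := 0) (z' := 0) hx hy hz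
        (by omega) (by omega) (by omega) (by simpa using hr)
      simp
    · have hi1 : i % (N + 1) ≤ N := Nat.le_of_lt_succ (Nat.mod_lt _ N.succ_pos)
      have hi2 : i / (N + 1) ≤ N := Nat.le_of_lt_succ (Nat.div_lt_of_lt_mul hi)
      obtain ⟨l1, l2, l3⟩ := hlt hi1 hi2
      obtain ⟨rfl, rfl, rfl⟩ := digits_unique hx hy hz l1 l2 l3 hr
      exact ⟨hi1, hi2, rfl⟩
  · rintro ⟨hx, hy, rfl⟩
    obtain ⟨l1, l2, l3⟩ := hlt hx hy
    refine ⟨l1, l2, l3, ?_⟩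
    have hi : x + (N + 1) * y < (N + 1) * (N + 1) := by
      have := Nat.mul_le_mul_left (N + 1) hy
      have : (N + 1) * (N + 1) = (N + 1) * N + (N + 1) := by ring
      omega
    obtain ⟨r, hr, hre⟩ := h2 _ hi
    have hmod : (x + (N + 1) * y) % (N + 1) = x := by
      rw [Nat.add_mul_mod_self_left, Nat.mod_eq_of_lt (by omega)]
    have hdiv : (x + (N + 1) * y) / (N + 1) = y := by
      rw [Nat.add_mul_div_left _ _ N.succ_pos, Nat.div_eq_of_lt (by omega), zero_add]
    simp only [e, hmod, hdiv] at hre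
    have step : ∀ {a b k : ℕ}, a < m → b < k → a + m * b < m * k := fun {a b k} ha hb => by
      have := Nat.mul_le_mul_left m hb
      rw [Nat.succ_eq_add_one, Nat.mul_add, Nat.mul_one] at this
      omega
    have hE : 1 + m * (x + m * (y + m * (x * y))) < m ^ 4 := by
      rw [show m ^ 4 = m * (m * (m * m)) by ring]
      exact step (by omega) (step l1 (step l2 l3))
    refine ⟨r / m ^ 4, ?_⟩
    rw [Nat.ModEq, Nat.mod_eq_of_lt hE] at hre
    convert hr
    rw [← Nat.mod_add_div r (m ^ 4), hre, Nat.add_mul_div_left _ _ (by positivity),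
      Nat.div_eq_of_lt hE]
    ring

/-! ### The ultraproduct -/

section Ultraproduct

variable (c : ℕ → Fin 2 → ℕ)

/-- The ultraproduct of the structures `ScaledNat (c N)`. -/
def UltraNat : Type := (Filter.hyperfilter ℕ : Filter ℕ).Product fun N => ScaledNat (c N)

namespace UltraNat

/-- The class of a sequence. -/
noncomputable def mk (x : ℕ → ℕ) : UltraNat c :=
  Quotient.mk' (s := (Filter.hyperfilter ℕ : Filter ℕ).productSetoid fun N => ScaledNat (c N)) x

variable {c}

theorem mk_eq {x y : ℕ → ℕ} : mk c x = mk c y ↔ ∀ᶠ N in Filter.hyperfilter ℕ, x N = y N :=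
  Quotient.eq''

theorem mk_surjective : Function.Surjective (mk c) :=
  fun x => Quotient.inductionOn' x fun y => ⟨y, rfl⟩

/-- The ultraproduct as a first-order structure. -/
noncomputable abbrev prodStructure : (linLang (Fin 2)).Structure (UltraNat c) :=
  Ultraproduct.structure (M := fun N => ScaledNat (c N)) (u := Filter.hyperfilter ℕ)

/-- The data of the ultraproduct, read off from its first-order structure. -/
noncomputable instance : LinStruct (Fin 2) (UltraNat c) :=
  letI := prodStructure (c := c)
  { zero := funMap (L := linLang (Fin 2)) LinFunc.zero ![]
    one := funMap (L := linLang (Fin 2)) LinFunc.one ![]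
    add := fun x y => funMap (L := linLang (Fin 2)) LinFunc.add ![x, y]
    le := fun x y => RelMap (L := linLang (Fin 2)) OrdRel.le ![x, y]
    scalar := fun i x => funMap (L := linLang (Fin 2)) (LinFunc.scalar i) ![x] }

theorem linStructure_eq : (linStructure : (linLang (Fin 2)).Structure (UltraNat c)) =
    prodStructure := by
  refine Structure.ext ?_ ?_
  · funext n f x
    cases f with
    | zero => exact congrArg (prodStructure.funMap LinFunc.zero) (funext fun i : Fin 0 => i.elim0)
    | one => exact congrArg (prodStructure.funMap LinFunc.one) (funext fun i : Fin 0 => i.elim0)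
    | add =>
      exact congrArg (prodStructure.funMap LinFunc.add)
        (funext fun i : Fin 2 => by fin_cases i <;> rfl)
    | scalar α =>
      exact congrArg (prodStructure.funMap (LinFunc.scalar α))
        (funext fun i : Fin 1 => by fin_cases i; rfl)
  · funext n r x
    cases r with
    | le =>
      exact congrArg (prodStructure.RelMap OrdRel.le)
        (funext fun i : Fin 2 => by fin_cases i <;> rfl)

/-- The theorem of Łoś. -/
theorem realize_mk {α : Type*} (φ : (linLang (Fin 2)).Formula α) (x : α → ℕ → ℕ) :
    φ.Realize (fun i => mk c (x i)) ↔
      ∀ᶠ N in Filter.hyperfilter ℕ, φ.Realize (M := ScaledNat (c N)) fun i => x i N := by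
  rw [linStructure_eq]
  have : ∀ N, Nonempty (ScaledNat (c N)) := fun N => ⟨(0 : ℕ)⟩
  exact Ultraproduct.realize_formula_cast (M := fun N => ScaledNat (c N)) φ x

theorem funMap_mk {n : ℕ} (f : (linLang (Fin 2)).Functions n) (x : Fin n → ℕ → ℕ) :
    prodStructure.funMap f (fun i => mk c (x i)) =
      mk c fun N => funMap (M := ScaledNat (c N)) f fun i => x i N :=
  Ultraproduct.funMap_cast (M := fun N => ScaledNat (c N)) f x

theorem zero_def : (0 : UltraNat c) = mk c fun _ => 0 :=
  (congrArg (prodStructure.funMap LinFunc.zero) (funext fun i : Fin 0 => i.elim0)).trans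
    (funMap_mk (n := 0) LinFunc.zero ![])

theorem one_def : (1 : UltraNat c) = mk c fun _ => 1 :=
  (congrArg (prodStructure.funMap LinFunc.one) (funext fun i : Fin 0 => i.elim0)).trans
    (funMap_mk (n := 0) LinFunc.one ![])

theorem add_def (x y : ℕ → ℕ) : mk c x + mk c y = mk c fun N => x N + y N :=
  (congrArg (prodStructure.funMap LinFunc.add)
    (funext fun i : Fin 2 => by fin_cases i <;> rfl)).trans (funMap_mk (n := 2) LinFunc.add ![x, y])

theorem scalar_def (i : Fin 2) (x : ℕ → ℕ) :
    scalar i (mk c x) = mk c fun N => c N i * x N :=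
  (congrArg (prodStructure.funMap (LinFunc.scalar i))
    (funext fun j : Fin 1 => by fin_cases j; rfl)).trans
      (funMap_mk (n := 1) (LinFunc.scalar i) ![x])

theorem mk_le {x y : ℕ → ℕ} : mk c x ≤ mk c y ↔ ∀ᶠ N in Filter.hyperfilter ℕ, x N ≤ y N := by
  have h := realize_mk (c := c) (fLe (.var 0) (.var 1)) ![x, y]
  simp only [realize_fLe, Term.realize_var] at h
  exact h

instance : IsLAModel (UltraNat c) where
  zero_ne_succ z := by
    obtain ⟨z, rfl⟩ := mk_surjective z
    rw [zero_def, one_def, add_def, Ne, mk_eq]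
    simp [(Filter.hyperfilter ℕ).neBot.ne]
  succ_inj x y := by
    obtain ⟨x, rfl⟩ := mk_surjective x
    obtain ⟨y, rfl⟩ := mk_surjective y
    simp [one_def, add_def, mk_eq]
  add_zero' x := by
    obtain ⟨x, rfl⟩ := mk_surjective x
    simp [zero_def, add_def]
  add_succ x y := by
    obtain ⟨x, rfl⟩ := mk_surjective x
    obtain ⟨y, rfl⟩ := mk_surjective y
    simp [one_def, add_def, add_assoc]
  le_iff x y := by
    obtain ⟨x, rfl⟩ := mk_surjective x
    obtain ⟨y, rfl⟩ := mk_surjective y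
    rw [mk_le]
    constructor
    · intro h
      refine ⟨mk c fun N => y N - x N, ?_⟩
      rw [add_def, mk_eq]
      filter_upwards [h] with N hN
      omega
    · rintro ⟨z, hz⟩
      obtain ⟨z, rfl⟩ := mk_surjective z
      rw [add_def, mk_eq] at hz
      filter_upwards [hz] with N hN
      omega
  scalar_succ i x := by
    obtain ⟨x, rfl⟩ := mk_surjective x
    simp [one_def, add_def, scalar_def, mul_add]
  scalar_comm i j x := by
    obtain ⟨x, rfl⟩ := mk_surjective x
    simp [scalar_def, mul_left_comm]
  induction n φ y h0 hs x := by
    obtain ⟨x, rfl⟩ := mk_surjective x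
    choose y' hy' using fun i => mk_surjective (c := c) (y i)
    obtain rfl : (fun i => mk c (y' i)) = y := funext hy'
    have key : ∀ x : ℕ → ℕ, φ.Realize (Sum.elim (fun i => mk c (y' i)) fun _ => mk c x) ↔
        ∀ᶠ N in Filter.hyperfilter ℕ,
          φ.Realize (M := ScaledNat (c N)) (Sum.elim (fun i => y' i N) fun _ => x N) := by
      intro x
      convert realize_mk φ (Sum.elim y' fun _ => x) using 2
      · ext i; rcases i with i | i <;> rfl
      · funext N
        refine congrArg _ (funext fun i => ?_)
        rcases i with i | i <;> rfl
    by_contra hx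
    rw [key, ← Ultrafilter.eventually_not] at hx
    rw [zero_def, key] at h0
    -- by induction in the factors there is a counterexample to the induction step
    have hw : ∀ N, ∃ w : ℕ,
        φ.Realize (M := ScaledNat (c N)) (Sum.elim (fun i => y' i N) fun _ => (0 : ℕ)) →
        ¬ φ.Realize (M := ScaledNat (c N)) (Sum.elim (fun i => y' i N) fun _ => x N) →
        φ.Realize (M := ScaledNat (c N)) (Sum.elim (fun i => y' i N) fun _ => w) ∧
        ¬ φ.Realize (M := ScaledNat (c N)) (Sum.elim (fun i => y' i N) fun _ => (w + 1 : ℕ)) := by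
      intro N
      by_contra! h
      obtain ⟨h1, h2, -⟩ := h 0
      have : ∀ w : ℕ, φ.Realize (M := ScaledNat (c N)) (Sum.elim (fun i => y' i N) fun _ => w) :=
        fun w => Nat.rec h1 (fun w ih => (h w).2.2 ih) w
      exact h2 (this _)
    choose w hw using hw
    have h1 := (key w).2 (by filter_upwards [h0, hx] with N h h' using (hw N h h').1)
    have h2 := hs _ h1
    rw [one_def, add_def, key] at h2
    have h3 := ((h2.and h0).and hx).exists
    obtain ⟨N, ⟨h2, h0⟩, hx⟩ := h3
    exact (hw N h0 hx).2 h2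

end UltraNat

end Ultraproduct

/-- There is a model with two scalars in which the multiplication on some non-standard interval
is definable without parameters. -/
theorem exists_model_with_mul :
    ∃ (M : Type) (_ : LinStruct (Fin 2) M) (_ : IsLAModel M) (L : M) (mul : M → M → M),
      IsNonstandard L ∧ IsMulOn L mul ∧
        (∅ : Set M).Definable (linLang (Fin 2)) (mulGraph L mul) := by
  choose c hc using exists_scalars
  let rep : UltraNat c → ℕ → ℕ := fun x => (UltraNat.mk_surjective x).choose
  have hrep : ∀ x, UltraNat.mk c (rep x) = x := fun x => (UltraNat.mk_surjective x).choose_spec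
  have hcast : ∀ k : ℕ, (Nat.unaryCast k : UltraNat c) = UltraNat.mk c fun _ => k := by
    intro k
    induction k with
    | zero => exact UltraNat.zero_def
    | succ k ih => rw [Nat.unaryCast, ih, UltraNat.one_def, UltraNat.add_def]
  have hmul : ∀ x y : ℕ → ℕ, (UltraNat.mk c fun N => rep (UltraNat.mk c x) N *
      rep (UltraNat.mk c y) N) = UltraNat.mk c fun N => x N * y N := fun x y => by
    rw [UltraNat.mk_eq]
    filter_upwards [UltraNat.mk_eq.1 (hrep (UltraNat.mk c x)),
      UltraNat.mk_eq.1 (hrep (UltraNat.mk c y))] with N h1 h2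
    rw [h1, h2]
  refine ⟨UltraNat c, inferInstance, inferInstance, UltraNat.mk c fun N => N,
    fun x y => UltraNat.mk c fun N => rep x N * rep y N, fun k hk => ?_,
    ⟨fun x _ => ?_, fun x y _ _ => ?_⟩, ?_⟩
  · rw [hcast, UltraNat.mk_eq] at hk
    have : {k}ᶜ ∈ Filter.hyperfilter ℕ :=
      Filter.compl_mem_hyperfilter_of_finite (Set.finite_singleton k)
    obtain ⟨N, h1, h2⟩ := (hk.and this).exists
    exact h2 h1
  · obtain ⟨x, rfl⟩ := UltraNat.mk_surjective x
    rw [UltraNat.zero_def, hmul]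
    simp
  · obtain ⟨x, rfl⟩ := UltraNat.mk_surjective x
    obtain ⟨y, rfl⟩ := UltraNat.mk_surjective y
    rw [UltraNat.one_def, UltraNat.add_def, hmul, hmul, UltraNat.add_def]
    rfl
  · rw [Set.empty_definable_iff]
    refine ⟨fLinMul, Set.ext fun v => ?_⟩
    choose v' hv' using fun i => UltraNat.mk_surjective (c := c) (v i)
    obtain rfl : (fun i => UltraNat.mk c (v' i)) = v := funext hv'
    change _ ↔ fLinMul.Realize _
    have h : ∀ N, fLinMul.Realize (M := ScaledNat (c N)) (fun i => v' i N) ↔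
        v' 0 N ≤ N ∧ v' 1 N ≤ N ∧ v' 2 N = v' 0 N * v' 1 N :=
      fun N => (realize_fLinMul _).trans (hc N _ _ _)
    rw [UltraNat.realize_mk, Filter.eventually_congr (.of_forall h), Filter.eventually_and,
      Filter.eventually_and, ← UltraNat.mk_eq, ← UltraNat.mk_le, ← UltraNat.mk_le, ← hmul]
    rfl

/-! ### Interpretation of the model in its ordered module -/

section Transfer

universe u v

variable {κ : Type v} {M : Type u} [LinStruct κ M] [IsLAModel M]

attribute [local instance] addCommMonoid linearOrder isOrderedCancelAddMonoid

/-- The term `0` in the language of ordered modules. -/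
def mZero {R : Type*} {α : Type*} : (ordModLang R).Term α :=
  Constants.term (L := ordModLang R) ModFunc.zero

/-- The atomic formula `s ≤ t` in the language of ordered modules. -/
def mLe {R : Type*} {α : Type*} (s t : (ordModLang R).Term α) : (ordModLang R).Formula α :=
  Relations.formula₂ (L := ordModLang R) OrdRel.le s t

section

variable {R A : Type*} [Ring R] [AddCommGroup A] [LE A] [Module R A] {α : Type*} (e : α → A)

theorem realize_mZero : (mZero : (ordModLang R).Term α).realize e = 0 := rfl

theorem realize_mLe (s t : (ordModLang R).Term α) :
    (mLe s t).Realize e ↔ s.realize e ≤ t.realize e :=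
  Formula.realize_rel₂ (L := ordModLang R) (M := A)

/-- The formula saying that `t` is the least positive element. -/
noncomputable def mLeastPos (t : (ordModLang R).Term α) : (ordModLang R).Formula α :=
  ∼(mLe t mZero) ⊓ Formula.iAlls (Fin 1)
    ((mLe (.var (.inr 0)) mZero) ⊔ mLe (t.relabel Sum.inl) (.var (.inr 0)))

theorem realize_mLeastPos (t : (ordModLang R).Term α) :
    (mLeastPos t).Realize e ↔ ¬ t.realize e ≤ 0 ∧ ∀ x : A, x ≤ 0 ∨ t.realize e ≤ x := by
  simp only [mLeastPos, Formula.realize_inf, Formula.realize_not, Formula.realize_iAlls,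
    Formula.realize_sup, realize_mLe, realize_mZero, Term.realize_var, Term.realize_relabel,
    Sum.elim_inr, Sum.elim_comp_inl]
  exact and_congr_right fun _ => ⟨fun h x => h fun _ => x, fun h i => h (i 0)⟩

end

theorem leastPos_iff {z : Ext M} : (¬ z ≤ 0 ∧ ∀ x : Ext M, x ≤ 0 ∨ z ≤ x) ↔ z = Ext.of 1 := by
  constructor
  · rintro ⟨h1, h2⟩
    exact le_antisymm ((h2 _).resolve_left Ext.zero_lt_of_one.not_ge)
      (Ext.one_le_of_pos (not_le.1 h1))
  · rintro rfl
    exact ⟨Ext.zero_lt_of_one.not_ge, fun x => (le_or_gt x 0).imp_right Ext.one_le_of_pos⟩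

/-- A term of linear arithmetic becomes a term in the language of ordered modules, where the
variable `o` stands for the constant `1`. -/
theorem exists_module_term {β γ : Type*} (j : β → γ) (o : γ) (t : (linLang κ).Term β) :
    ∃ t' : (ordModLang (ScalarRing M)).Term γ, ∀ (v : γ → Ext M) (w : β → M), v o = Ext.of 1 →
      (∀ b, v (j b) = Ext.of (w b)) → t'.realize v = Ext.of (t.realize w) := by
  induction t with
  | var b => exact ⟨.var (j b), fun v w _ h => h b⟩
  | @func n f ts ih =>
    choose ts' h using ih
    cases f with
    | zero => exact ⟨mZero, fun v w _ _ => (map_zero Ext.of).symm⟩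
    | one => exact ⟨.var o, fun v w ho _ => ho⟩
    | add =>
      exact ⟨.func (ModFunc.add : (ordModLang (ScalarRing M)).Functions 2) ts', fun v w ho hj =>
        (congrArg₂ (· + ·) (h 0 v w ho hj) (h 1 v w ho hj)).trans (map_add Ext.of _ _).symm⟩
    | scalar c =>
      exact ⟨.func (ModFunc.smul (ScalarRing.mk M (.X c)) :
        (ordModLang (ScalarRing M)).Functions 1) ts', fun v w ho hj =>
        (congrArg (ScalarRing.mk M (.X c) • ·) (h 0 v w ho hj)).trans (Ext.X_smul_of c _)⟩

/-- A formula of linear arithmetic, with its quantifiers restricted to nonnegative elements and an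
additional variable for the constant `1`, expresses in the module what it says in the model. -/
theorem exists_module_formula {α : Type*} {n : ℕ} (φ : (linLang κ).BoundedFormula α n) :
    ∃ φ' : (ordModLang (ScalarRing M)).BoundedFormula (Option α) n, ∀ (w : α → M) (xs : Fin n → M),
      φ'.Realize (fun o : Option α => o.elim (Ext.of 1) fun a => Ext.of (w a))
        (fun i => Ext.of (xs i)) ↔ φ.Realize w xs := by
  have term : ∀ {n : ℕ} (t : (linLang κ).Term (α ⊕ Fin n)),
      ∃ t' : (ordModLang (ScalarRing M)).Term (Option α ⊕ Fin n), ∀ (w : α → M) (xs : Fin n → M),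
        t'.realize (Sum.elim (fun o : Option α => o.elim (Ext.of 1) fun a => Ext.of (w a))
          fun i => Ext.of (xs i)) = Ext.of (t.realize (Sum.elim w xs)) := fun t => by
    obtain ⟨t', h⟩ := exists_module_term (M := M) (Sum.map some id) (.inl none) t
    exact ⟨t', fun w xs => h _ _ rfl (by rintro (b | b) <;> rfl)⟩
  induction φ with
  | falsum => exact ⟨⊥, fun _ _ => Iff.rfl⟩
  | equal t₁ t₂ =>
    obtain ⟨t₁', h₁⟩ := term t₁
    obtain ⟨t₂', h₂⟩ := term t₂
    refine ⟨t₁'.bdEqual t₂', fun w xs => ?_⟩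
    rw [BoundedFormula.realize_bdEqual, h₁, h₂, Ext.of_injective.eq_iff]
    rfl
  | rel r ts =>
    cases r with
    | le =>
      obtain ⟨t₁', h₁⟩ := term (ts 0)
      obtain ⟨t₂', h₂⟩ := term (ts 1)
      refine ⟨Relations.boundedFormula₂ (L := ordModLang (ScalarRing M)) OrdRel.le t₁' t₂',
        fun w xs => ?_⟩
      have h := Ext.of_le_of (x := (ts 0).realize (Sum.elim w xs))
        (y := (ts 1).realize (Sum.elim w xs))
      rw [← h₁, ← h₂] at h
      exact h
  | imp φ ψ ih₁ ih₂ =>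
    obtain ⟨φ', h₁⟩ := ih₁
    obtain ⟨ψ', h₂⟩ := ih₂
    refine ⟨φ'.imp ψ', fun w xs => ?_⟩
    rw [BoundedFormula.realize_imp, BoundedFormula.realize_imp, h₁, h₂]
  | @all n φ ih =>
    obtain ⟨φ', h⟩ := ih
    refine ⟨((Relations.boundedFormula₂ (L := ordModLang (ScalarRing M)) OrdRel.le
      mZero (.var (.inr (Fin.last n)))).imp φ').all, fun w xs => ?_⟩
    have hs : ∀ x : M, (Fin.snoc (fun i => Ext.of (xs i)) (Ext.of x) : Fin (n + 1) → Ext M) =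
        fun i => Ext.of ((Fin.snoc xs x : Fin (n + 1) → M) i) := fun x =>
      (Fin.comp_snoc (Ext.of : M → Ext M) xs x).symm
    have hle : ∀ z : Ext M, (Relations.boundedFormula₂ (L := ordModLang (ScalarRing M)) OrdRel.le
        mZero (.var (.inr (Fin.last n)))).Realize
        (fun o : Option α => o.elim (Ext.of 1) fun a => Ext.of (w a))
        (Fin.snoc (fun i => Ext.of (xs i)) z : Fin (n + 1) → Ext M) ↔ 0 ≤ z := fun z => by
      have : (Fin.snoc (fun i => Ext.of (xs i)) z : Fin (n + 1) → Ext M) (Fin.last n) = z :=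
        Fin.snoc_last _ _
      conv_rhs => rw [← this]
      exact Iff.rfl
    simp only [BoundedFormula.realize_all, BoundedFormula.realize_imp, hle]
    constructor
    · intro H x
      rw [← h, ← hs]
      exact H _ (Ext.of_nonneg x)
    · intro H z hz
      obtain ⟨x, rfl⟩ := Ext.exists_of_nonneg hz
      rw [hs, h]
      exact H x

/-- A relation definable in the model is definable in its ordered module: the additional variable
of `exists_module_formula` is set to the least positive element. -/
theorem definable_image_of {P : Set M} {k : ℕ} {T : Set (Fin k → M)}
    (hT : P.Definable (linLang κ) T) :
    (Ext.of '' P).Definable (ordModLang (ScalarRing M))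
      {v : Fin k → Ext M | ∃ w ∈ T, v = fun i => Ext.of (w i)} := by
  obtain ⟨φ, rfl⟩ := Set.definable_iff_exists_formula_sum.1 hT
  obtain ⟨φ', hφ⟩ := exists_module_formula (M := M) φ
  let f : Option (P ⊕ Fin k) → (↥(Ext.of '' P) ⊕ Fin k) ⊕ Fin 1 := fun o =>
    o.elim (.inr 0) (Sum.elim (fun p => .inl (.inl ⟨Ext.of p.1, p.1, p.2, rfl⟩))
      fun i => .inl (.inr i))
  have hpos : ∀ l : List (Fin k),
      ∃ θ : (ordModLang (ScalarRing M)).Formula (↥(Ext.of '' P) ⊕ Fin k),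
      ∀ e : ↥(Ext.of '' P) ⊕ Fin k → Ext M, θ.Realize e ↔ ∀ i ∈ l, 0 ≤ e (.inr i) := by
    intro l
    induction l with
    | nil => exact ⟨⊤, by simp⟩
    | cons i l ih =>
      obtain ⟨θ, h⟩ := ih
      exact ⟨mLe mZero (.var (.inr i)) ⊓ θ, fun e => by
        rw [Formula.realize_inf, h, realize_mLe, List.forall_mem_cons]; rfl⟩
  obtain ⟨θ, hθ⟩ := hpos (List.finRange k)
  refine Set.definable_iff_exists_formula_sum.2 ⟨θ ⊓ Formula.iExs (Fin 1)
    (mLeastPos (.var (.inr 0)) ⊓ Formula.relabel f φ'), Set.ext fun v => ?_⟩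
  have hreal : ∀ w : Fin k → M, (Formula.relabel f φ').Realize
      (Sum.elim (Sum.elim (fun p : ↥(Ext.of '' P) => (p : Ext M)) fun i => Ext.of (w i))
        fun _ => Ext.of 1) ↔
      φ.Realize (Sum.elim (fun p : P => (p : M)) w) := fun w => by
    rw [Formula.realize_relabel]
    refine Iff.trans (iff_of_eq ?_) (hφ (Sum.elim (fun p : P => (p : M)) w) default)
    refine congrArg₂ _ (funext ?_) (Subsingleton.elim _ _)
    rintro (_ | _ | _) <;> rfl
  change (∃ w ∈ {w | _}, _) ↔ Formula.Realize _ _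
  simp only [Formula.realize_inf, hθ, Formula.realize_iExs, realize_mLeastPos, Term.realize_var,
    Sum.elim_inr, leastPos_iff, List.mem_finRange, true_implies]
  constructor
  · rintro ⟨w, hw, rfl⟩
    exact ⟨fun i => Ext.of_nonneg _, fun _ => Ext.of 1, rfl, (hreal w).2 hw⟩
  · rintro ⟨h0, z, hz, h⟩
    choose w hw using fun i => Ext.exists_of_nonneg (h0 i)
    obtain rfl : v = fun i => Ext.of (w i) := funext hw
    obtain rfl : z = fun _ => Ext.of 1 := funext fun i => by rw [Subsingleton.elim i 0, hz]
    exact ⟨w, (hreal w).1 h, rfl⟩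

theorem definable_divRel {L : M} {mul : M → M → M} {P : Set M}
    (h : P.Definable (linLang κ) (mulGraph L mul)) :
    (Ext.of '' P).Definable (ordModLang (ScalarRing M))
      {v : Fin 2 → Ext M | DivRel L mul (v 0) (v 1)} := by
  have hle : P.Definable (linLang κ) {v : Fin 2 ⊕ Fin 1 → M | v (.inr 0) ≤ v (.inl 1)} :=
    Set.definable_iff_exists_formula_sum.2 ⟨fLe (.var (.inr (.inr 0))) (.var (.inr (.inl 1))),
      Set.ext fun v => by
        change v (.inr 0) ≤ v (.inl 1) ↔ Formula.Realize _ _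
        rw [realize_fLe]
        rfl⟩
  have hT := (hle.inter (h.preimage_comp
    (![.inr 0, .inl 0, .inl 1] : Fin 3 → Fin 2 ⊕ Fin 1))).exists_of_finite
  convert definable_image_of hT using 1
  ext v
  constructor
  · rintro ⟨z, x, y, hx, hy, h1, h2, h3, h4⟩
    refine ⟨![x, y], ⟨fun _ => z, h1, h2, h3, h4.symm⟩, funext fun i => ?_⟩
    fin_cases i
    exacts [hx, hy]
  · rintro ⟨w, ⟨u, h1, h2, h3, h4⟩, rfl⟩
    exact ⟨u 0, w 0, w 1, rfl, rfl, h1, h2, h3, h4.symm⟩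

/-! ### Divisibility of standard numbers -/

theorem of_unaryCast (i : ℕ) : Ext.of (Nat.unaryCast i : M) = i • Ext.of (1 : M) := by
  induction i with
  | zero => rw [zero_smul]; exact map_zero Ext.of
  | succ i ih => rw [Nat.unaryCast, map_add, ih, succ_nsmul]

theorem eq_unaryCast_of_le {x : M} {i : ℕ} (h : x ≤ Nat.unaryCast i) :
    ∃ k : ℕ, x = Nat.unaryCast k := by
  induction i generalizing x with
  | zero => exact ⟨0, le_antisymm h (zero_le' x)⟩
  | succ i ih =>
    by_cases h0 : x = 0
    · exact ⟨0, h0⟩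
    · obtain ⟨y, rfl⟩ := exists_pred h0
      obtain ⟨k, rfl⟩ := ih (x := y) (le_of_add_le_add_right h)
      exact ⟨k + 1, rfl⟩

theorem IsNonstandard.unaryCast_le {L : M} (hL : IsNonstandard L) (i : ℕ) : Nat.unaryCast i ≤ L :=
  (le_total' _ _).resolve_right fun h => by
    obtain ⟨k, hk⟩ := eq_unaryCast_of_le h
    exact hL k hk

theorem IsMulOn.of_mul_unaryCast {L : M} {mul : M → M → M} (hL : IsNonstandard L)
    (hm : IsMulOn L mul) {z : M} (hz : z ≤ L) (i : ℕ) :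
    Ext.of (mul z (Nat.unaryCast i)) = i • Ext.of z := by
  induction i with
  | zero => rw [zero_smul, ← map_zero Ext.of]; exact congrArg _ (hm.mul_zero z hz)
  | succ i ih => rw [Nat.unaryCast, hm.mul_succ z _ hz (hL.unaryCast_le (i + 1)), map_add, ih,
      succ_nsmul]

theorem divRel_iff_dvd {L : M} {mul : M → M → M} (hL : IsNonstandard L)
    (hm : IsMulOn L mul) (i j : ℕ) :
    DivRel L mul (i • Ext.of (1 : M)) (j • Ext.of (1 : M)) ↔ i ∣ j := by
  have hinj : Function.Injective fun k : ℕ => k • Ext.of (1 : M) :=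
    (nsmul_left_strictMono Ext.zero_lt_of_one).injective
  constructor
  · rintro ⟨z, x, y, hx, hy, h1, h2, -, h4⟩
    rw [← of_unaryCast, Ext.of_injective.eq_iff] at hx hy
    subst hx hy
    obtain ⟨k, rfl⟩ := eq_unaryCast_of_le h1
    have := hm.of_mul_unaryCast hL h2 i
    rw [h4, of_unaryCast, of_unaryCast, ← mul_nsmul] at this
    exact ⟨k, by rw [hinj this, mul_comm]⟩
  · rintro ⟨k, rfl⟩
    -- for `i = 0` the quotient `k` is arbitrary and need not be below `i * k = 0`
    obtain ⟨k', hk, hle⟩ : ∃ k', i * k = i * k' ∧ k' ≤ i * k := by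
      rcases Nat.eq_zero_or_pos i with rfl | hi
      · exact ⟨0, by simp, Nat.zero_le _⟩
      · exact ⟨k, rfl, Nat.le_mul_of_pos_left k hi⟩
    refine ⟨Nat.unaryCast k', Nat.unaryCast i, Nat.unaryCast (i * k), (of_unaryCast _).symm,
      (of_unaryCast _).symm, ?_, hL.unaryCast_le _, hL.unaryCast_le _, Ext.of_injective ?_⟩
    · rw [← Ext.of_le_of, of_unaryCast, of_unaryCast]
      exact nsmul_le_nsmul_left Ext.zero_lt_of_one.le hle
    · rw [hm.of_mul_unaryCast hL (hL.unaryCast_le _), of_unaryCast, of_unaryCast, ← mul_nsmul, hk,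
        mul_comm]

end Transfer

/-! ### Independence with parameters -/

/-- Divisibility is independent: take distinct primes and their products. -/
theorem hasIndependenceProperty_dvd : HasIndependenceProperty fun i j : ℕ => i ∣ j := by
  classical
  intro n
  refine ⟨fun i => Nat.nth Nat.Prime i, fun J => ∏ i with i ∈ J, Nat.nth Nat.Prime i,
    fun i J => ⟨fun h => ?_, fun h => Finset.dvd_prod_of_mem _ (by simpa using h)⟩⟩
  obtain ⟨j, hj, hdvd⟩ := (Nat.prime_nth_prime i).prime.exists_mem_finset_dvd h
  have := (Nat.prime_dvd_prime_iff_eq (Nat.prime_nth_prime i) (Nat.prime_nth_prime j)).1 hdvd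
  have hij : i = j := Fin.ext (Nat.nth_injective Nat.infinite_setOfPred_prime this)
  rw [hij]
  simpa using hj

theorem HasIndependenceProperty.map {X Y X' Y' : Type*} {R : X → Y → Prop} {S : X' → Y' → Prop}
    (h : HasIndependenceProperty R) (f : X → X') (g : Y → Y') (hS : ∀ x y, S (f x) (g y) ↔ R x y) :
    HasIndependenceProperty S := fun n => by
  obtain ⟨a, b, hab⟩ := h n
  exact ⟨fun i => f (a i), fun J => g (b J), fun i J => (hS _ _).trans (hab i J)⟩

theorem hasIndependenceProperty_divRel {κ : Type*} {M : Type*} [LinStruct κ M] [IsLAModel M]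
    {L : M} {mul : M → M → M} (hL : IsNonstandard L) (hm : IsMulOn L mul) :
    HasIndependenceProperty (DivRel L mul) :=
  hasIndependenceProperty_dvd.map (fun i => i • Ext.of (1 : M)) (fun j => j • Ext.of (1 : M))
    (divRel_iff_dvd hL hm)

/-- A relation with the independence property that is definable with parameters refutes NIP: the
finitely many parameters can be moved into the second tuple of variables. -/
theorem not_isNIP_of_definable {L : FirstOrder.Language} {A : Type*} [L.Structure A] {P : Set A}
    {R : A → A → Prop} (hR : P.Definable L {v : Fin 2 → A | R (v 0) (v 1)})
    (h : HasIndependenceProperty R) : ¬ IsNIP L A := by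
  obtain ⟨F, -, hF⟩ := Set.definable_iff_finitely_definable.1 hR
  obtain ⟨φ, hφ⟩ := Set.definable_iff_exists_formula_sum.1 hF
  have hφ' : ∀ v : Fin 2 → A, R (v 0) (v 1) ↔ φ.Realize (Sum.elim (↑) v) := fun v =>
    iff_of_eq (congrArg (v ∈ ·) hφ)
  let e := F.equivFin
  let f : ↥(F : Set A) ⊕ Fin 2 → Fin 1 ⊕ Fin (F.card + 1) :=
    Sum.elim (fun a => .inr (e a).succ) ![.inl 0, .inr 0]
  intro hnip
  refine hnip 1 (F.card + 1) (Formula.relabel f φ) (h.map (fun x _ => x)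
    (fun y => Fin.cons y fun j => (e.symm j : A)) fun x y => ?_)
  rw [Formula.realize_relabel]
  refine Iff.trans (iff_of_eq (congrArg _ (funext ?_))) (hφ' ![x, y]).symm
  rintro (a | i)
  · simp [f]
  · fin_cases i <;> rfl

end LinearArithmetic

open LinearArithmetic in
theorem proposition4p1 :
    -- every model of `LA₂` with a definable multiplication on a non-standard `[0, L]²`
    (∀ (M : Type*) [LinStruct (Fin 2) M] [IsLAModel M] (L : M) (mul : M → M → M) (P : Set M),
      IsNonstandard L → IsMulOn L mul → P.Definable (linLang (Fin 2)) (mulGraph L mul) →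
        (Ext.of '' P).Definable (ordModLang (ScalarRing M))
          {v : Fin 2 → Ext M | DivRel L mul (v 0) (v 1)} ∧
        (∀ i j : ℕ, DivRel L mul (i • Ext.of (1 : M)) (j • Ext.of (1 : M)) ↔ i ∣ j) ∧
        HasIndependenceProperty (DivRel L mul) ∧
        ¬ IsNIP (ordModLang (ScalarRing M)) (Ext M)) ∧
    -- such models exist, even with a parameter-free definition of the multiplication
    (∃ (M : Type) (_ : LinStruct (Fin 2) M) (_ : IsLAModel M) (L : M) (mul : M → M → M),
      IsNonstandard L ∧ IsMulOn L mul ∧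
        (∅ : Set M).Definable (linLang (Fin 2)) (mulGraph L mul)) ∧
    -- hence not all discretely ordered modules are NIP
    (∃ (R A : Type) (_ : CommRing R) (_ : LinearOrder R) (_ : AddCommGroup A) (_ : LinearOrder A)
      (_ : Module R A), IsDiscretelyOrderedModule R A ∧ ¬ IsNIP (ordModLang R) A) := by
  refine ⟨fun M _ _ L mul P hL hm hP => ⟨definable_divRel hP, divRel_iff_dvd hL hm,
    hasIndependenceProperty_divRel hL hm,
    not_isNIP_of_definable (definable_divRel hP) (hasIndependenceProperty_divRel hL hm)⟩,
    exists_model_with_mul, ?_⟩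
  obtain ⟨M, _, _, L, mul, hL, hm, hdef⟩ := exists_model_with_mul
  exact ⟨ScalarRing M, Ext M, inferInstance, inferInstance, inferInstance, inferInstance,
    inferInstance, ext_isDiscretelyOrderedModule M,
    not_isNIP_of_definable (definable_divRel hdef) (hasIndependenceProperty_divRel hL hm)⟩
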